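/- Let $K$ be an oriented knot in $S^3$, that is, the image of an embedding $k\colon S^1\to S^3$, and let $N\subset S^3$ be a closed solid torus neighbourhood of $K$: $N$ is the image of an embedding $e\colon S^1\times D^2\to S^3$ with $e(z,0)=k(z)$ for all $z\in S^1$. Write $\partial N=e(S^1\times\partial D^2)$ for its boundary torus. Let $\eta\colon S^1\to\partial N$ be an essential simple closed curve, i.e. $\eta$ is continuous and injective and its class in $H_1(\partial N;\mathbb Z)$ is nonzero. Then the following are equivalent: (1) $\eta$ is homologically trivial in $N$, i.e. $[\eta]=0$ in $H_1(N;\mathbb Z)$; (2) $\eta$ is homotopically trivial in $N$, i.e. $\eta$, regarded as a map $S^1\to N$, is homotopic to a constant map; (3) $\eta$ bounds a disk in $N$, i.e. there is an embedding $d\colon D^2\to N$ with $d(\partial D^2)=\eta(S^1)$. -/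

import Mathlib

open CategoryTheory AlgebraicTopology
open scoped Simplicial

noncomputable section

namespace KnotTorus

/-- The 3-sphere, as the unit sphere of Euclidean 4-space. -/
abbrev S3 : Type := Metric.sphere (0 : EuclideanSpace ℝ (Fin 4)) 1

/-- The closed unit disk in the plane `ℂ`. -/
abbrev ClosedDisk : Type := Metric.closedBall (0 : ℂ) 1

/-- The centre of the closed disk. -/
def ClosedDisk.center : ClosedDisk := ⟨0, by simp⟩

/-- The boundary circle of the closed disk. -/
def ClosedDisk.boundary : Set ClosedDisk := {z | ‖(z : ℂ)‖ = 1}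

/-- The standard solid torus. -/
abbrev SolidTorus : Type := Circle × ClosedDisk

/-- An oriented knot in the 3-sphere: an embedded circle, oriented by its parametrization. -/
structure OrientedKnot where
  toFun : Circle → S3
  isEmbedding : Topology.IsEmbedding toFun

/-- A solid torus embedded in the 3-sphere whose core is the knot `K`. -/
structure SolidTorusNbhd (K : OrientedKnot) where
  toFun : SolidTorus → S3
  isEmbedding : Topology.IsEmbedding toFun
  core : ∀ z : Circle, toFun (z, ClosedDisk.center) = K.toFun z

namespace SolidTorusNbhd

variable {K : OrientedKnot}

/-- The embedded solid torus `N` as a subset of the 3-sphere. -/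
def carrier (N : SolidTorusNbhd K) : Set S3 := Set.range N.toFun

/-- The boundary torus `∂N`: the image of `S¹ × ∂D²`. -/
def boundary (N : SolidTorusNbhd K) : Set S3 := N.toFun '' {p | p.2 ∈ ClosedDisk.boundary}

theorem boundary_subset (N : SolidTorusNbhd K) : N.boundary ⊆ N.carrier :=
  Set.image_subset_range _ _

/-- The inclusion of `∂N` into `N`. -/
def boundaryInclusion (N : SolidTorusNbhd K) : C(N.boundary, N.carrier) :=
  ⟨Set.inclusion N.boundary_subset, continuous_inclusion N.boundary_subset⟩

end SolidTorusNbhd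

section Homology

variable {X : Type} [TopologicalSpace X]

/-- The singular 1-simplex of a closed curve `γ`: the point of the standard 1-simplex with
barycentric coordinates `(1 - t, t)` goes to `γ (exp (2 π i t))`. -/
def curveSimplex (γ : C(Circle, X)) : (TopCat.toSSet.obj (TopCat.of X)) _⦋1⦌ :=
  (TopCat.toSSetObjEquiv (TopCat.of X) (Opposite.op ⦋1⦌)).symm
    ⟨fun s => γ (Circle.exp (2 * Real.pi * s.1 1)), by
      refine γ.continuous.comp (Circle.exp.continuous.comp (continuous_const.mul ?_))
      exact (continuous_apply 1).comp continuous_subtype_val⟩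

/-- The singular chain complex of `X` with integer coefficients. -/
abbrev singularChains (X : Type) [TopologicalSpace X] : ChainComplex (ModuleCat ℤ) ℕ :=
  ((singularChainComplexFunctor (ModuleCat ℤ)).obj (ModuleCat.of ℤ ℤ)).obj (TopCat.of X)

/-- The first singular homology group of `X` with integer coefficients. -/
abbrev H1 (X : Type) [TopologicalSpace X] : ModuleCat ℤ :=
  ((singularHomologyFunctor (ModuleCat ℤ) 1).obj (ModuleCat.of ℤ ℤ)).obj (TopCat.of X)

/-- The singular 1-chain of a closed curve, as the map from `ℤ` that sends `1` to it. -/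
def curveChain (γ : C(Circle, X)) : ModuleCat.of ℤ ℤ ⟶ (singularChains X).X 1 :=
  SSet.ιChainComplex (TopCat.toSSet.obj (TopCat.of X)) (curveSimplex γ)

theorem curveSimplex_faces (γ : C(Circle, X)) :
    (TopCat.toSSet.obj (TopCat.of X)).δ 0 (curveSimplex γ) =
      (TopCat.toSSet.obj (TopCat.of X)).δ 1 (curveSimplex γ) := by
  apply (TopCat.toSSetObjEquiv (TopCat.of X) (Opposite.op ⦋0⦌)).injective
  ext s
  change γ (Circle.exp (2 * Real.pi * (stdSimplex.map (SimplexCategory.δ (0 : Fin 2)) s).1 1)) =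
    γ (Circle.exp (2 * Real.pi * (stdSimplex.map (SimplexCategory.δ (1 : Fin 2)) s).1 1))
  obtain rfl : s = stdSimplex.vertex 0 := Subsingleton.elim (α := stdSimplex ℝ (Fin 1)) _ _
  rw [stdSimplex.map_vertex, stdSimplex.map_vertex]
  have h0 : SimplexCategory.δ (0 : Fin 2) (0 : Fin 1) = (1 : Fin 2) := rfl
  have h1 : SimplexCategory.δ (1 : Fin 2) (0 : Fin 1) = (0 : Fin 2) := rfl
  rw [h0, h1]
  simp

theorem curveChain_d (γ : C(Circle, X)) : curveChain γ ≫ (singularChains X).d 1 0 = 0 := by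
  refine (SSet.ιChainComplex_d _ _ (curveSimplex γ)).trans ?_
  simp [Fin.sum_univ_two, curveSimplex_faces]
  rfl

/-- The class in the first singular homology group of the 1-cycle given by a closed curve. -/
def curveClass (γ : C(Circle, X)) : H1 X :=
  ((singularChains X).liftCycles (curveChain γ) 0 (by simp) (curveChain_d γ) ≫
    (singularChains X).homologyπ 1).hom (1 : ℤ)

end Homology

variable {K : OrientedKnot}

/-- A closed curve on `∂N`, viewed as a closed curve in `N`. -/
def pushIn (N : SolidTorusNbhd K) (η : C(Circle, N.boundary)) : C(Circle, N.carrier) :=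
  N.boundaryInclusion.comp η

/-- An essential curve on `∂N`: a simple closed curve whose class in `H₁(∂N)` is nontrivial. -/
def IsEssential (N : SolidTorusNbhd K) (η : C(Circle, N.boundary)) : Prop :=
  Function.Injective η ∧ curveClass η ≠ 0

/-- A closed curve in a space bounds a disk: there is an embedded closed disk whose boundary circle
is the curve. -/
def BoundsDisk {X : Type} [TopologicalSpace X] (γ : C(Circle, X)) : Prop :=
  ∃ d : ClosedDisk → X, Topology.IsEmbedding d ∧ d '' ClosedDisk.boundary = Set.range γ

end KnotTorus

end

/-! A disk is contractible, so (3) gives (2), and homotopy invariance of homology takes (2) to (1).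
The content is (1) ⇒ (3). In the coordinates `Circle × ClosedDisk` of `N`, write η = (a, b) with b
on the unit circle. The increment of the argument is a singular cocycle, so [η] = 0 yields a real
lift α of a (`exists_lift_of_curveClass_eq_zero`). The map b has no real lift: otherwise η would be
nullhomotopic on ∂N (`nullhomotopic_of_lifts`), against essentiality.

Now unroll the first coordinate. The cover ℝ × S¹ of the boundary torus is ℂ∖{0} through (s, u) ↦
eˢu, with deck group generated by multiplication by exp(2π). The lifted curve J = exp(α)·b is a
Jordan curve winding around 0, and simplicity of η says that J is disjoint from its nontrivial deck
translates. Let U be the component of 0 off J. Its Riemann map Φ with Φ(0) = 0 extends to an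
injection of the closed disk that carries the circle onto J (`exists_jordan_domain`). Write Φ(z) =
zψ(z). The required disk is z ↦ (exp(i log|ψ|), zψ/|ψ|). Its second coordinate has modulus |z|, so
two points with the same image satisfy |z| = |z'| and Φ(z) = exp(2πm)Φ(z'). For m > 0 the
contraction by exp(-2πm) maps the closure of U into U, and the Schwarz lemma forces z = 0; for m = 0
injectivity of Φ concludes (`exists_meridian_disk`).

The plane topology rests on continuous logarithms: they glue along connected intersections
(`HasContLog.union`), while z - w has none on the frontier of a bounded open set around w
(`not_hasContLog_frontier`). The Riemann map comes from the extremal problem for |f'(0)| with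
Koebe's square root trick, and its boundary extension from the length-area method. -/

namespace KnotTorus

/-! ### Plane topology by continuous logarithms. -/

section PlaneTopology

open Set Metric Topology Complex

/-- The function `f` has a continuous logarithm on the set `K`. -/
def HasContLog {X : Type*} [TopologicalSpace X] (K : Set X) (f : X → ℂ) : Prop :=
  ∃ L : X → ℂ, ContinuousOn L K ∧ ∀ z ∈ K, Complex.exp (L z) = f z

namespace HasContLog

variable {X : Type*} [TopologicalSpace X] {K S T : Set X} {f g : X → ℂ}

theorem mono (h : HasContLog K f) (hS : S ⊆ K) : HasContLog S f :=
  let ⟨L, hL, hf⟩ := h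
  ⟨L, hL.mono hS, fun z hz => hf z (hS hz)⟩

theorem congr (h : HasContLog K f) (hfg : ∀ z ∈ K, f z = g z) : HasContLog K g :=
  let ⟨L, hL, hf⟩ := h
  ⟨L, hL, fun z hz => (hf z hz).trans (hfg z hz)⟩

theorem mul (hf : HasContLog K f) (hg : HasContLog K g) : HasContLog K (fun z => f z * g z) :=
  let ⟨L, hL, hLf⟩ := hf
  let ⟨M, hM, hMg⟩ := hg
  ⟨fun z => L z + M z, hL.add hM, fun z hz => by rw [Complex.exp_add, hLf z hz, hMg z hz]⟩

theorem inv (hf : HasContLog K f) : HasContLog K (fun z => (f z)⁻¹) :=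
  let ⟨L, hL, hLf⟩ := hf
  ⟨fun z => -L z, hL.neg, fun z hz => by rw [Complex.exp_neg, hLf z hz]⟩

theorem div (hf : HasContLog K f) (hg : HasContLog K g) : HasContLog K (fun z => f z / g z) := by
  simpa only [div_eq_mul_inv] using hf.mul hg.inv

theorem const {c : ℂ} (hc : c ≠ 0) : HasContLog K (fun _ => c) :=
  ⟨fun _ => Complex.log c, continuousOn_const, fun _ _ => Complex.exp_log hc⟩

theorem comp {Y : Type*} [TopologicalSpace Y] {φ : Y → X} {A : Set Y} (h : HasContLog K f)
    (hφ : ContinuousOn φ A) (hA : MapsTo φ A K) : HasContLog A (fun y => f (φ y)) :=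
  let ⟨L, hL, hf⟩ := h
  ⟨fun y => L (φ y), hL.comp hφ hA, fun _ hy => hf _ (hA hy)⟩

theorem of_re_pos (hf : ContinuousOn f K) (h : ∀ z ∈ K, 0 < (f z).re) : HasContLog K f :=
  ⟨fun z => Complex.log (f z), hf.clog fun z hz => Or.inl (h z hz), fun z hz =>
    Complex.exp_log fun h0 => by simpa [h0] using h z hz⟩

/-- Division by `c` moves the values into the unit disk about 1, hence into the right half-plane,
where the principal branch is continuous. -/
theorem of_norm_sub_lt {c : ℂ} (hf : ContinuousOn f K) (h : ∀ z ∈ K, ‖f z - c‖ < ‖c‖) :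
    HasContLog K f := by
  by_cases hK : K = ∅
  · subst hK; exact ⟨fun _ => 0, continuousOn_empty _, by simp⟩
  obtain ⟨x, hx⟩ := nonempty_iff_ne_empty.mpr hK
  have hc : c ≠ 0 := norm_pos_iff.mp ((norm_nonneg _).trans_lt (h x hx))
  have h1 : HasContLog K (fun z => f z / c) := by
    refine of_re_pos (hf.div_const c) fun z hz => ?_
    have h2 : ‖f z / c - 1‖ < 1 := by
      rw [div_sub_one hc, norm_div, div_lt_one (norm_pos_iff.mpr hc)]
      exact h z hz
    have h3 := (Complex.abs_re_le_norm (f z / c - 1)).trans_lt h2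
    rw [Complex.sub_re, Complex.one_re, abs_lt] at h3
    linarith [h3.1]
  exact (h1.mul (const hc)).congr fun z _ => div_mul_cancel₀ _ hc

/-- Two continuous logarithms on a preconnected set differ by a constant. -/
theorem exists_int_eq {L M : X → ℂ} (hK : IsPreconnected K) (hL : ContinuousOn L K)
    (hM : ContinuousOn M K) (h : ∀ z ∈ K, Complex.exp (L z) = Complex.exp (M z)) :
    ∃ n : ℤ, ∀ z ∈ K, L z = M z + n * (2 * Real.pi * I) := by
  by_cases hK0 : K = ∅
  · subst hK0; exact ⟨0, by simp⟩
  obtain ⟨x, hx⟩ := nonempty_iff_ne_empty.mpr hK0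
  have hd : IsDiscrete (range ((↑) : ℤ → ℂ)) :=
    ⟨(Complex.isClosedEmbedding_intCast.isEmbedding.toHomeomorph).discreteTopology⟩
  have hpi : (2 * Real.pi * I : ℂ) ≠ 0 := Complex.two_pi_I_ne_zero
  have hmaps : MapsTo (fun z => (L z - M z) / (2 * Real.pi * I)) K (range ((↑) : ℤ → ℂ)) := by
    intro z hz
    obtain ⟨n, hn⟩ := Complex.exp_eq_exp_iff_exists_int.mp (h z hz)
    refine ⟨n, ?_⟩
    simp only [hn, add_sub_cancel_left]
    field_simp
  obtain ⟨n, hn⟩ := hmaps hx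
  refine ⟨n, fun z hz => ?_⟩
  have h1 := hK.constant_of_mapsTo hd ((hL.sub hM).div_const _) hmaps hz hx
  simp only [Pi.sub_apply] at h1 hn
  rw [← hn, div_eq_iff hpi] at h1
  linear_combination h1

/-- Continuous logarithms on two closed sets with preconnected intersection can be glued. -/
theorem union (hS : IsClosed S) (hT : IsClosed T) (hST : IsPreconnected (S ∩ T))
    (h1 : HasContLog S f) (h2 : HasContLog T f) : HasContLog (S ∪ T) f := by
  classical
  obtain ⟨L, hL, hLf⟩ := h1
  obtain ⟨M, hM, hMf⟩ := h2
  obtain ⟨n, hn⟩ := exists_int_eq hST (hL.mono inter_subset_left) (hM.mono inter_subset_right)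
    fun z hz => (hLf z hz.1).trans (hMf z hz.2).symm
  have hG1 : EqOn (fun z => if z ∈ S then L z else M z + n * (2 * Real.pi * I)) L S :=
    fun z hz => if_pos hz
  have hG2 : EqOn (fun z => if z ∈ S then L z else M z + n * (2 * Real.pi * I))
      (fun z => M z + n * (2 * Real.pi * I)) T := by
    intro z hz
    by_cases hzS : z ∈ S
    · simp only [hzS, if_true]; exact hn z ⟨hzS, hz⟩
    · simp only [hzS, if_false]
  refine ⟨fun z => if z ∈ S then L z else M z + n * (2 * Real.pi * I), ?_, ?_⟩
  · exact (hL.congr hG1).union_of_isClosed ((hM.add continuousOn_const).congr hG2) hS hT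
  · rintro z (hz | hz)
    · rw [hG1 hz, hLf z hz]
    · rw [hG2 hz, Complex.exp_add, hMf z hz, Complex.exp_int_mul_two_pi_mul_I, mul_one]

end HasContLog

/-- The plane is simply connected, so `g` lifts through the covering `exp` of ℂ∖{0}. -/
theorem hasContLog_univ {g : ℂ → ℂ} (hg : Continuous g) (h0 : ∀ z, g z ≠ 0) :
    HasContLog univ g := by
  obtain ⟨F, ⟨-, hF⟩, -⟩ := Complex.isCoveringMapOn_exp.existsUnique_continuousMap_lifts
    (⟨g, hg⟩ : C(ℂ, ℂ)) (a₀ := 0) (e₀ := Complex.log (g 0)) (Complex.exp_log (h0 0))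
    (fun a => h0 a)
  exact ⟨F, F.continuous.continuousOn, fun z _ => congrFun hF z⟩

/-- The condition is a symmetric and transitive relation between `w` and `w₀`, and it holds for
nearby points because the quotient is then close to 1. Connectedness of `C` spreads it to all pairs.
In effect, points that `K` does not separate are wound around equally. -/
theorem hasContLog_sub_div_sub {K C : Set ℂ} (hK : IsClosed K) (hC : IsPreconnected C)
    (hCK : Disjoint C K) {w w₀ : ℂ} (hw : w ∈ C) (hw₀ : w₀ ∈ C) :
    HasContLog K (fun z => (z - w) / (z - w₀)) := by
  have hne : ∀ x ∈ C, ∀ z ∈ K, z - x ≠ 0 := fun x hx z hz h =>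
    disjoint_left.mp hCK hx (sub_eq_zero.mp h ▸ hz)
  refine hC.induction₂ (fun w w₀ => HasContLog K (fun z => (z - w) / (z - w₀))) ?_ ?_ ?_ hw hw₀
  · intro x hx
    have hx' : x ∈ Kᶜ := disjoint_left.mp hCK hx
    obtain ⟨ε, hε, hb⟩ := Metric.isOpen_iff.mp hK.isOpen_compl x hx'
    filter_upwards [mem_nhdsWithin_of_mem_nhds (Metric.ball_mem_nhds x hε),
      self_mem_nhdsWithin] with y hy hyC
    have key : HasContLog K (fun z => (z - y) / (z - x)) := by
      refine HasContLog.of_norm_sub_lt (c := 1) ?_ ?_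
      · exact (continuousOn_id.sub continuousOn_const).div
          (continuousOn_id.sub continuousOn_const) fun z hz => hne x hx z hz
      · intro z hz
        have hzx := hne x hx z hz
        have h1 : (z - y) / (z - x) - 1 = (x - y) / (z - x) := by field_simp; ring
        rw [h1, norm_div, norm_one, div_lt_one (norm_pos_iff.mpr hzx)]
        have h2 : ε ≤ dist z x := by
          by_contra hlt
          exact hb (Metric.mem_ball.mpr (not_le.mp hlt)) hz
        rw [← dist_eq_norm, ← dist_eq_norm, dist_comm x y]
        exact (Metric.mem_ball.mp hy).trans_le h2
    exact key.inv.congr fun z _ => inv_div _ _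
  · intro x y z _ hy _ h1 h2
    refine (h1.mul h2).congr fun u hu => ?_
    have := hne y hy u hu
    field_simp
  · intro x y _ _ h
    exact h.inv.congr fun z _ => inv_div _ _

/-- A continuous function on the plane that agrees with `z - w` off a bounded set vanishes
somewhere. -/
theorem exists_eq_zero_of_eq_sub {G : ℂ → ℂ} (hG : Continuous G) {w : ℂ} {R : ℝ} (hR : 0 < R)
    (h : ∀ z, dist z w = R → G z = z - w) : ∃ z, G z = 0 := by
  by_contra! h0
  obtain ⟨L, hL, hLG⟩ := hasContLog_univ hG h0
  have hL' : Continuous L := continuousOn_univ.mp hL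
  have hc : Continuous fun θ : ℝ => L (w + R * Complex.exp (θ * I)) := by fun_prop
  obtain ⟨n, hn⟩ := HasContLog.exists_int_eq (K := (univ : Set ℝ)) isPreconnected_univ
    hc.continuousOn (M := fun θ : ℝ => Real.log R + θ * I)
    (by fun_prop) (by
      intro θ _
      rw [hLG _ (mem_univ _), h _ (by simp [hR.le]), add_sub_cancel_left, Complex.exp_add,
        ← Complex.ofReal_exp, Real.exp_log hR])
  -- Between θ = 0 and θ = 2π the left side of `hn` returns to its value, while the right side grows
  -- by 2πi.
  have h1 := hn 0 (mem_univ _)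
  have h2 := hn (2 * Real.pi) (mem_univ _)
  simp only [Complex.ofReal_zero, zero_mul, Complex.exp_zero, mul_one, Complex.ofReal_mul,
    Complex.ofReal_ofNat, Complex.exp_two_pi_mul_I] at h1 h2
  have h3 : (2 * Real.pi * I : ℂ) = 0 := by linear_combination h1 - h2
  exact Complex.two_pi_I_ne_zero h3

/-- Borsuk's criterion: the function `z - w` has no continuous logarithm on the frontier of a
bounded open set containing `w`, even after division by a function without zeros on the closure. -/
theorem not_hasContLog_frontier {V : Set ℂ} (hb : Bornology.IsBounded V) {w : ℂ}
    (hw : w ∈ V) {u : ℂ → ℂ} (hu : ContinuousOn u (closure V)) (hu0 : ∀ z ∈ closure V, u z ≠ 0) :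
    ¬ HasContLog (frontier V) (fun z => (z - w) / u z) := by
  classical
  rintro ⟨L, hL, hLu⟩
  -- Tietze extends the logarithm to the plane. Then exp(M)·u on `V` and z - w off `V` fit together
  -- to a continuous function without zeros that equals z - w on a large circle, which is
  -- impossible.
  obtain ⟨M, hM⟩ := ContinuousMap.exists_restrict_eq (isClosed_frontier (s := V))
    ⟨(frontier V).domRestrict L, continuousOn_iff_continuous_domRestrict.mp hL⟩
  have hM' : ∀ z ∈ frontier V, M z = L z := fun z hz => DFunLike.congr_fun hM ⟨z, hz⟩
  obtain ⟨R, hR⟩ := (hb.subset_ball_lt 0 w)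
  have hG : Continuous (V.piecewise (fun z => Complex.exp (M z) * u z) (fun z => z - w)) := by
    rw [← continuousOn_univ]
    refine ContinuousOn.piecewise ?_ ?_ (by fun_prop)
    · rintro z ⟨-, hz⟩
      rw [hM' z hz, hLu z hz, div_mul_cancel₀ _ (hu0 z (frontier_subset_closure hz))]
    · rw [univ_inter]
      exact (M.continuous.cexp.continuousOn).mul hu
  obtain ⟨z, hz⟩ := exists_eq_zero_of_eq_sub hG hR.1 (w := w) fun z hz => by
    refine piecewise_eq_of_notMem _ _ _ fun hzV => ?_
    have := Metric.mem_ball.mp (hR.2 hzV)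
    linarith
  by_cases hzV : z ∈ V
  · rw [piecewise_eq_of_mem _ _ _ hzV] at hz
    exact mul_ne_zero (Complex.exp_ne_zero _) (hu0 z (subset_closure hzV)) hz
  · rw [piecewise_eq_of_notMem _ _ _ hzV, sub_eq_zero] at hz
    exact hzV (hz ▸ hw)

/-- Unicoherence of the plane. -/
theorem isPreconnected_inter_of_union_eq_univ {U W : Set ℂ} (hU : IsOpen U) (hW : IsOpen W)
    (hUc : IsPreconnected U) (hWc : IsPreconnected W) (h : U ∪ W = univ) :
    IsPreconnected (U ∩ W) := by
  classical
  intro A B hA hB hAB hneA hneB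
  by_contra hne
  have hdisj : ∀ z ∈ U ∩ W, z ∈ A → z ∉ B := fun z hz ha hb => hne ⟨z, hz, ha, hb⟩
  set P : Set ℂ := U ∩ W ∩ A with hP
  have hPo : IsOpen P := (hU.inter hW).inter hA
  -- With `t` equal to 0 off `W` and 1 off `U`, put 2πi·t on `P` (0 elsewhere) over `U` and 2πi·(t -
  -- 1) on `P` (0 elsewhere) over `W`. The exponentials agree and define a map on the plane. A
  -- global logarithm of it would make the difference of the two functions constant on U ∩ W, but
  -- that difference is 2πi on `P` and 0 on the rest.
  obtain ⟨t, ht0, ht1, -⟩ := exists_continuous_zero_one_of_isClosed hW.isClosed_compl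
    hU.isClosed_compl (by
      rw [disjoint_compl_left_iff_subset]
      intro z hz
      by_contra hzW
      have : z ∈ U ∪ W := h ▸ mem_univ z
      exact this.elim hz hzW)
  have hfr : ∀ z ∈ frontier P, z ∉ U ∩ W := by
    intro z hz hzUW
    rw [hPo.frontier_eq] at hz
    have hzB : z ∈ B := (hAB hzUW).resolve_left fun hzA => hz.2 ⟨hzUW, hzA⟩
    obtain ⟨y, hy, hyP⟩ := mem_closure_iff.mp hz.1 _ ((hU.inter hW).inter hB) ⟨hzUW, hzB⟩
    exact hdisj y hyP.1 hyP.2 hy.2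
  have ha : ContinuousOn (fun z => if z ∈ P then 2 * Real.pi * I * (t z : ℂ) else 0) U := by
    refine ContinuousOn.if ?_ (by fun_prop) (by fun_prop)
    rintro z ⟨hzU, hz⟩
    have : z ∈ Wᶜ := fun hzW => hfr z hz ⟨hzU, hzW⟩
    simp [ht0 this]
  have hb : ContinuousOn (fun z => if z ∈ P then 2 * Real.pi * I * ((t z : ℂ) - 1) else 0) W := by
    refine ContinuousOn.if ?_ (by fun_prop) (by fun_prop)
    rintro z ⟨hzW, hz⟩
    have : z ∈ Uᶜ := fun hzU => hfr z hz ⟨hzU, hzW⟩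
    simp [ht1 this]
  have hab : ∀ z, Complex.exp (if z ∈ P then 2 * Real.pi * I * (t z : ℂ) else 0) =
      Complex.exp (if z ∈ P then 2 * Real.pi * I * ((t z : ℂ) - 1) else 0) := by
    intro z
    split_ifs
    · rw [mul_sub, mul_one, Complex.exp_sub, Complex.exp_two_pi_mul_I, div_one]
    · rfl
  have hE : Continuous fun z => Complex.exp (if z ∈ P then 2 * Real.pi * I * (t z : ℂ) else 0) := by
    rw [← continuousOn_univ, ← h]
    intro z hz
    rcases hz with hz | hz
    · exact ((ha.continuousAt (hU.mem_nhds hz)).cexp).continuousWithinAt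
    · simp_rw [hab]
      exact ((hb.continuousAt (hW.mem_nhds hz)).cexp).continuousWithinAt
  obtain ⟨T, hT, hTE⟩ := hasContLog_univ hE fun z => Complex.exp_ne_zero _
  obtain ⟨n, hn⟩ := HasContLog.exists_int_eq hUc (hT.mono (subset_univ _)) ha
    fun z _ => hTE z (mem_univ z)
  obtain ⟨m, hm⟩ := HasContLog.exists_int_eq hWc (hT.mono (subset_univ _)) hb
    fun z _ => (hTE z (mem_univ z)).trans (hab z)
  obtain ⟨x, hx, hxA⟩ := hneA
  obtain ⟨y, hy, hyB⟩ := hneB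
  have hxP : x ∈ P := ⟨hx, hxA⟩
  have hyP : y ∉ P := fun hyP => hdisj y hy hyP.2 hyB
  have h1 := hn x hx.1
  have h2 := hm x hx.2
  have h3 := hn y hy.1
  have h4 := hm y hy.2
  simp only [hxP, hyP, if_true, if_false] at h1 h2 h3 h4
  have : (2 * Real.pi * I : ℂ) = 0 := by linear_combination h2 - h1 + h3 - h4
  exact Complex.two_pi_I_ne_zero this

/-- A frontier point outside `F` would have an open component of its own that meets, and hence
equals, the given one; but an open set contains none of its frontier. -/
theorem frontier_connectedComponentIn_subset {F : Set ℂ} (hF : IsClosed F) (x : ℂ) :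
    frontier (connectedComponentIn Fᶜ x) ⊆ F := by
  intro z hz
  by_contra hzF
  have ho := hF.isOpen_compl.connectedComponentIn (x := x)
  rw [ho.frontier_eq] at hz
  obtain ⟨y, hy, hyx⟩ := mem_closure_iff.mp hz.1 _ (hF.isOpen_compl.connectedComponentIn (x := z))
    (mem_connectedComponentIn hzF)
  apply hz.2
  rw [connectedComponentIn_eq hyx, ← connectedComponentIn_eq hy]
  exact mem_connectedComponentIn hzF

/-- The complement of a component of the complement of a closed connected set is connected. -/
theorem isPreconnected_compl_connectedComponentIn {J : Set ℂ} (hJ : IsClosed J)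
    (hJc : IsConnected J) (x : ℂ) : IsPreconnected (connectedComponentIn Jᶜ x)ᶜ := by
  obtain ⟨p, hp⟩ := hJc.nonempty
  have hJsub : J ⊆ (connectedComponentIn Jᶜ x)ᶜ := fun z hz hzc =>
    connectedComponentIn_subset _ _ hzc hz
  refine isPreconnected_of_forall p fun y hy => ?_
  by_cases hyJ : y ∈ J
  · exact ⟨J, hJsub, hp, hyJ, hJc.isPreconnected⟩
  set U := connectedComponentIn Jᶜ y with hU
  have hyU : y ∈ U := mem_connectedComponentIn hyJ
  have hUo : IsOpen U := hJ.isOpen_compl.connectedComponentIn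
  have hfr : (frontier U).Nonempty := by
    rw [nonempty_iff_ne_empty, Ne, frontier_eq_empty_iff]
    rintro (h | h)
    · exact (h ▸ hyU : y ∈ (∅ : Set ℂ))
    · exact connectedComponentIn_subset Jᶜ y (h ▸ mem_univ p : p ∈ U) hp
  obtain ⟨q, hq⟩ := hfr
  have hqJ := frontier_connectedComponentIn_subset hJ y hq
  -- Every other component `U` of the complement touches `J` at a frontier point `q`, so it is
  -- joined to `J` through `q`.
  refine ⟨J ∪ insert q U, ?_, Or.inl hp, Or.inr (Or.inr hyU), ?_⟩
  · rintro z (hz | rfl | hz)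
    · exact hJsub hz
    · exact hJsub hqJ
    · intro hzx
      apply hy
      rw [connectedComponentIn_eq hzx, ← connectedComponentIn_eq hz]
      exact hyU
  · refine hJc.isPreconnected.union q hqJ (mem_insert q U) ?_
    exact isPreconnected_connectedComponentIn.subset_closure (subset_insert q U)
      (insert_subset (frontier_subset_closure hq) subset_closure)

/-- Slide `w` within its component to a point `w'` of modulus larger than any in `K`. There z - w'
stays closer to -w' than 0 does. -/
theorem hasContLog_sub_of_not_isBounded {K : Set ℂ} (hK : IsCompact K) {w : ℂ}
    (hb : ¬ Bornology.IsBounded (connectedComponentIn Kᶜ w)) : HasContLog K (fun z => z - w) := by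
  have hw : w ∈ Kᶜ := by
    by_contra hw
    rw [connectedComponentIn_eq_empty hw] at hb
    exact hb Bornology.isBounded_empty
  obtain ⟨R, hR⟩ := hK.isBounded.subset_closedBall 0
  obtain ⟨w', hw', hw'R⟩ : ∃ w' ∈ connectedComponentIn Kᶜ w, R < ‖w'‖ := by
    by_contra! hcon
    exact hb ((Metric.isBounded_closedBall (x := (0 : ℂ)) (r := R)).subset fun z hz => by
      simpa using hcon z hz)
  have hlt : ∀ z ∈ K, ‖z‖ < ‖w'‖ := fun z hz =>
    lt_of_le_of_lt (by simpa using hR hz) hw'R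
  have h1 := hasContLog_sub_div_sub hK.isClosed isPreconnected_connectedComponentIn
    (disjoint_left.mpr fun z hz => connectedComponentIn_subset _ _ hz)
    (mem_connectedComponentIn hw) hw'
  have h2 : HasContLog K (fun z => z - w') :=
    HasContLog.of_norm_sub_lt (c := -w') (by fun_prop) fun z hz => by
      simpa using hlt z hz
  refine (h1.mul h2).congr fun z hz => div_mul_cancel₀ _ fun h => ?_
  rw [sub_eq_zero] at h
  exact absurd (hlt z hz) (h ▸ lt_irrefl _)

end PlaneTopology

end KnotTorus

namespace KnotTorus

/-! ### Injective holomorphic functions and their limits. -/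

section InjectiveHolomorphic

open Set Metric Topology Filter

variable {U : Set ℂ} {f : ℂ → ℂ}

theorem frequently_ne_of_injOn (hU : IsOpen U) (hinj : InjOn f U) {z : ℂ} (hz : z ∈ U) :
    ∃ᶠ w in 𝓝 z, f w ≠ f z := by
  intro h
  have h1 : ∀ᶠ w in 𝓝[≠] z, False := by
    filter_upwards [nhdsWithin_le_nhds h, nhdsWithin_le_nhds (hU.mem_nhds hz),
      self_mem_nhdsWithin] with w hw hwU hne
    exact hne (hinj hwU hz (not_not.mp hw))
  exact (h1.exists).elim fun _ h => h

theorem isOpen_image_of_injOn (hU : IsOpen U) (hf : DifferentiableOn ℂ f U) (hinj : InjOn f U)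
    {V : Set ℂ} (hVU : V ⊆ U) (hV : IsOpen V) : IsOpen (f '' V) := by
  rw [isOpen_iff_mem_nhds]
  rintro _ ⟨z, hz, rfl⟩
  rcases (hf.analyticAt (hU.mem_nhds (hVU hz))).eventually_constant_or_nhds_le_map_nhds with h | h
  · exact absurd (h.mono fun w hw => not_not.mpr hw) (frequently_ne_of_injOn hU hinj (hVU hz))
  · exact h (image_mem_map (hV.mem_nhds hz))

/-- The inverse of an injective holomorphic function is holomorphic. -/
theorem exists_holomorphic_inverse (hU : IsOpen U) (hf : DifferentiableOn ℂ f U)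
    (hinj : InjOn f U) : ∃ g : ℂ → ℂ, DifferentiableOn ℂ g (f '' U) ∧ ∀ z ∈ U, g (f z) = z := by
  have hleft : ∀ z ∈ U, Function.invFunOn f U (f z) = z := fun z hz =>
    hinj.leftInvOn_invFunOn hz
  refine ⟨Function.invFunOn f U, ?_, hleft⟩
  set g := Function.invFunOn f U with hg
  have hopen : IsOpen (f '' U) := isOpen_image_of_injOn hU hf hinj subset_rfl hU
  have hcont : ∀ z ∈ U, ContinuousAt g (f z) := by
    intro z hz W hW
    rw [hleft z hz] at hW
    obtain ⟨V, hVW, hV, hzV⟩ := _root_.mem_nhds_iff.mp (inter_mem hW (hU.mem_nhds hz))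
    rw [mem_map]
    refine mem_of_superset ((isOpen_image_of_injOn hU hf hinj
      (hVW.trans inter_subset_right) hV).mem_nhds (mem_image_of_mem f hzV)) ?_
    rintro _ ⟨w, hw, rfl⟩
    simpa only [mem_preimage, hleft w (hVW hw).2] using (hVW hw).1
  have hfg : ∀ y ∈ f '' U, f (g y) = y := by
    rintro _ ⟨z, hz, rfl⟩
    rw [hleft z hz]
  have hderiv : ∀ z ∈ U, deriv f z ≠ 0 → DifferentiableAt ℂ g (f z) := by
    intro z hz h0
    refine (HasDerivAt.of_local_left_inverse (f := f) (f' := deriv f z) (hcont z hz) ?_ h0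
      ?_).differentiableAt
    · rw [hleft z hz]
      exact (hf.differentiableAt (hU.mem_nhds hz)).hasDerivAt
    · filter_upwards [hopen.mem_nhds (mem_image_of_mem f hz)] with y hy using hfg y hy
  rintro _ ⟨z, hz, rfl⟩
  refine DifferentiableAt.differentiableWithinAt ?_
  have han : AnalyticAt ℂ (deriv f) z := (hf.analyticAt (hU.mem_nhds hz)).deriv
  -- Injectivity prevents `f` from being locally constant, so zeros of `deriv f` are isolated. Since
  -- `g` is already continuous, the removable singularity theorem covers them, and there is no need
  -- to show that `deriv f` has no zeros.
  rcases han.eventually_eq_zero_or_eventually_ne_zero with h | h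
  · exfalso
    obtain ⟨r, hr, hball⟩ := Metric.eventually_nhds_iff_ball.mp (h.and (hU.mem_nhds hz))
    refine frequently_ne_of_injOn hU hinj hz ?_
    filter_upwards [ball_mem_nhds z hr] with w hw
    rw [not_not]
    exact (convex_ball z r).is_const_of_fderivWithin_eq_zero (𝕜 := ℂ)
      (hf.mono fun y hy => (hball y hy).2) (fun y hy => by
        rw [fderivWithin_of_isOpen isOpen_ball hy]
        ext
        simpa using (hball y hy).1) hw (mem_ball_self hr)
  · refine (Complex.analyticAt_of_differentiable_on_punctured_nhds_of_continuousAt ?_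
      (hcont z hz)).differentiableAt
    have ht : Tendsto g (𝓝[≠] (f z)) (𝓝[≠] z) := by
      refine tendsto_nhdsWithin_iff.mpr ⟨?_, ?_⟩
      · have := (hcont z hz).tendsto
        rw [hleft z hz] at this
        exact this.mono_left nhdsWithin_le_nhds
      · filter_upwards [self_mem_nhdsWithin,
          nhdsWithin_le_nhds (hopen.mem_nhds (mem_image_of_mem f hz))] with y hy hyU hgy
        exact hy (by rw [mem_singleton_iff, ← hfg y hyU, mem_singleton_iff.mp hgy])
    filter_upwards [ht.eventually h,
      nhdsWithin_le_nhds (hopen.mem_nhds (mem_image_of_mem f hz))] with y hy hyU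
    obtain ⟨w, hw, rfl⟩ := hyU
    rw [hleft w hw] at hy
    exact hderiv w hw hy

/-- Hurwitz: a nonconstant locally uniform limit of injective holomorphic functions is
injective. -/
theorem injOn_of_tendstoLocallyUniformlyOn {ι : Type*} {p : Filter ι} [p.NeBot] {F : ι → ℂ → ℂ}
    (hU : IsOpen U) (hUc : IsPreconnected U) (hF : TendstoLocallyUniformlyOn F f p U)
    (hd : ∀ n, DifferentiableOn ℂ (F n) U) (hinj : ∀ n, InjOn (F n) U) {c : ℂ} (hc : c ∈ U)
    (hfc : deriv f c ≠ 0) : InjOn f U := by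
  intro a ha b hb hab
  by_contra hne
  have hfd : DifferentiableOn ℂ f U := hF.differentiableOn (Eventually.of_forall hd) hU
  have hfa := hfd.analyticOnNhd hU
  rcases (hfa b hb).eventually_eq_or_eventually_ne (analyticAt_const (v := f b)) with h | h
  · have h1 := hfa.eqOn_of_preconnected_of_eventuallyEq analyticOnNhd_const hUc hb h
    have h2 : f =ᶠ[𝓝 c] fun _ => f b := by
      filter_upwards [hU.mem_nhds hc] with z hz using h1 hz
    exact hfc (by rw [h2.deriv_eq, deriv_const])
  have hne' : ∀ᶠ z in 𝓝 b, z ≠ a := isOpen_ne.mem_nhds (Ne.symm hne)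
  obtain ⟨ρ, hρ, hball⟩ := Metric.nhds_basis_closedBall.eventually_iff.mp
    ((eventually_nhdsWithin_iff.mp h).and (hne'.and (hU.mem_nhds hb)))
  have hsub : closedBall b ρ ⊆ U := fun z hz => (hball hz).2.2
  have hsph : ∀ z ∈ sphere b ρ, z ≠ b := fun z hz h0 => by
    rw [h0, mem_sphere, dist_self] at hz
    exact hρ.ne hz
  obtain ⟨z₀, hz₀, hmin⟩ := (isCompact_sphere b ρ).exists_isMinOn
    (NormedSpace.sphere_nonempty.mpr hρ.le) (f := fun z => ‖f z - f b‖)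
    (((hfd.continuousOn.mono (sphere_subset_closedBall.trans hsub)).sub continuousOn_const).norm)
  set m := ‖f z₀ - f b‖ with hm
  have hm0 : 0 < m := by
    rw [hm, norm_pos_iff, sub_ne_zero]
    exact (hball (sphere_subset_closedBall hz₀)).1 (hsph z₀ hz₀)
  have hunif := (tendstoLocallyUniformlyOn_iff_forall_isCompact hU).mp hF
    (insert a (closedBall b ρ)) (insert_subset ha hsub) ((isCompact_closedBall b ρ).insert a)
  obtain ⟨n, hn⟩ := (Metric.tendstoUniformlyOn_iff.mp hunif (m / 8) (by positivity)).exists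
  have hn' : ∀ z ∈ insert a (closedBall b ρ), ‖f z - F n z‖ < m / 8 := fun z hz => by
    rw [← dist_eq_norm]; exact hn z hz
  have hbmem : b ∈ insert a (closedBall b ρ) := Or.inr (mem_closedBall_self hρ.le)
  -- Two errors of m/8 leave |F n z - F n b| ≥ 3m/4 on the circle, so the image of the closed disk
  -- contains the ball of radius 3m/8 about F n b. As f a = f b, the value F n a is within m/4 of F
  -- n b and is thus taken in the disk too, although `a` lies outside it.
  have key := DiffContOnCl.ball_subset_image_closedBall (f := F n) (z₀ := b) (r := ρ)
    (ε := 3 * m / 4)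
    (DifferentiableOn.diffContOnCl ((hd n).mono (by rwa [closure_ball b hρ.ne']))) hρ
    (fun z hz => by
      have h1 : m ≤ ‖f z - f b‖ := hmin hz
      have h2 := hn' z (Or.inr (sphere_subset_closedBall hz))
      have h3 := hn' b hbmem
      have h4 : ‖f z - f b‖ ≤ ‖f z - F n z‖ + ‖F n z - F n b‖ + ‖f b - F n b‖ := by
        have : f z - f b = (f z - F n z) + (F n z - F n b) - (f b - F n b) := by ring
        rw [this]
        exact (norm_sub_le _ _).trans (add_le_add_left (norm_add_le _ _) _)
      linarith)
    (frequently_ne_of_injOn hU (hinj n) hb)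
  have hmem : F n a ∈ ball (F n b) (3 * m / 4 / 2) := by
    have h2 := hn' a (mem_insert _ _)
    have h3 := hn' b hbmem
    have h4 : ‖F n a - F n b‖ ≤ ‖f a - F n a‖ + ‖f b - F n b‖ := by
      have : F n a - F n b = (f b - F n b) - (f a - F n a) := by rw [hab]; ring
      rw [this, add_comm]
      exact norm_sub_le _ _
    rw [mem_ball, dist_eq_norm]
    linarith
  obtain ⟨w, hw, hwa⟩ := key hmem
  exact (hball hw).2.1 (hinj n (hsub hw) ha hwa)

/-- Near each point a continuous logarithm is a local inverse of `exp` composed with `f`. -/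
theorem HasContLog.exists_differentiableOn (hU : IsOpen U) (hf : DifferentiableOn ℂ f U)
    (h : HasContLog U f) :
    ∃ ℓ : ℂ → ℂ, DifferentiableOn ℂ ℓ U ∧ ∀ z ∈ U, Complex.exp (ℓ z) = f z := by
  obtain ⟨ℓ, hℓ, hexp⟩ := h
  refine ⟨ℓ, fun z hz => DifferentiableAt.differentiableWithinAt ?_, hexp⟩
  have hs := Complex.hasStrictDerivAt_exp (ℓ z)
  have h0 := Complex.exp_ne_zero (ℓ z)
  have h1 := (hℓ.continuousAt (hU.mem_nhds hz)).eventually (hs.eventually_left_inverse h0)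
  have h2 : ℓ =ᶠ[𝓝 z] fun y => HasStrictDerivAt.localInverse Complex.exp _ (ℓ z) hs h0 (f y) := by
    filter_upwards [h1, hU.mem_nhds hz] with y hy hyU
    rw [← hexp y hyU, hy]
  have h3 := (hs.to_localInverse h0).hasDerivAt.differentiableAt
  have h4 : DifferentiableAt ℂ (HasStrictDerivAt.localInverse Complex.exp _ (ℓ z) hs h0) (f z) := by
    simpa only [hexp z hz] using! h3
  exact (h4.comp z (hf.differentiableAt (hU.mem_nhds hz))).congr_of_eventuallyEq h2

/-- An ultrafilter limit of holomorphic functions into the unit disk is locally uniform. -/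
theorem exists_tendstoLocallyUniformlyOn_ultrafilter {ι : Type*} (p : Ultrafilter ι)
    {F : ι → ℂ → ℂ} (hU : IsOpen U) (hd : ∀ n, DifferentiableOn ℂ (F n) U)
    (hm : ∀ n, MapsTo (F n) U (ball 0 1)) :
    ∃ f : ℂ → ℂ, MapsTo f U (closedBall 0 1) ∧ TendstoLocallyUniformlyOn F f p U := by
  -- Along an ultrafilter compactness gives limits at all points at once, so no diagonal subsequence
  -- is needed. The Schwarz bound below, uniform in `n`, then makes the convergence locally uniform.
  have hlim : ∀ z, ∃ y, z ∈ U → y ∈ closedBall (0 : ℂ) 1 ∧ Tendsto (fun n => F n z) p (𝓝 y) := by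
    intro z
    by_cases hz : z ∈ U
    · obtain ⟨y, hy, hle⟩ := (isCompact_closedBall (0 : ℂ) 1).ultrafilter_le_nhds
        (p.map fun n => F n z) (by
          rw [le_principal_iff]
          exact Filter.mem_map.mpr (Filter.univ_mem' fun n => ball_subset_closedBall (hm n hz)))
      exact ⟨y, fun _ => ⟨hy, hle⟩⟩
    · exact ⟨0, fun h => absurd h hz⟩
  choose f hf using hlim
  refine ⟨f, fun z hz => (hf z hz).1, Metric.tendstoLocallyUniformlyOn_iff.mpr ?_⟩
  intro ε hε x hx
  obtain ⟨r, hr, hball⟩ := Metric.isOpen_iff.mp hU x hx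
  have hlip : ∀ n, ∀ y ∈ ball x r, dist (F n y) (F n x) ≤ 2 / r * dist y x := fun n y hy => by
    refine Complex.dist_le_div_mul_dist_of_mapsTo_ball ((hd n).mono hball) ?_ hy
    intro w hw
    have h1 := mem_ball_zero_iff.mp (hm n (hball hw))
    have h2 := mem_ball_zero_iff.mp (hm n hx)
    rw [mem_closedBall, dist_eq_norm]
    linarith [norm_sub_le (F n w) (F n x)]
  have hlip' : ∀ y ∈ ball x r, dist (f y) (f x) ≤ 2 / r * dist y x := fun y hy =>
    le_of_tendsto (((hf y (hball hy)).2.dist (hf x hx).2))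
      (Eventually.of_forall fun n => hlip n y hy)
  set δ := min r (ε * r / 8) with hδ
  have hδ0 : 0 < δ := lt_min hr (by positivity)
  refine ⟨ball x δ, mem_nhdsWithin_of_mem_nhds (ball_mem_nhds x hδ0), ?_⟩
  filter_upwards [(hf x hx).2 (ball_mem_nhds (f x) (show 0 < ε / 4 by positivity))] with n hn y hy
  have hyr : y ∈ ball x r := ball_subset_ball (min_le_left _ _) hy
  have hsmall : 2 / r * dist y x ≤ ε / 4 := by
    have h1 : dist y x ≤ ε * r / 8 := (mem_ball.mp hy).le.trans (min_le_right _ _)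
    calc 2 / r * dist y x ≤ 2 / r * (ε * r / 8) := by gcongr
      _ = ε / 4 := by field_simp; norm_num
  have h1 := hlip n y hyr
  have h2 := hlip' y hyr
  have h3 : dist (F n x) (f x) < ε / 4 := hn
  calc dist (f y) (F n y) ≤ dist (f y) (f x) + dist (f x) (F n x) + dist (F n x) (F n y) :=
        dist_triangle4 _ _ _ _
    _ < ε := by rw [dist_comm (f x), dist_comm (F n x) (F n y)]; linarith

end InjectiveHolomorphic

end KnotTorus

namespace KnotTorus

/-! ### The Riemann mapping theorem. -/

section Riemann

open Set Metric Topology Filter ComplexConjugate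

variable {U : Set ℂ} {f : ℂ → ℂ}

theorem isPreconnected_thickening {P : Set ℂ} (hP : IsPreconnected P) (δ : ℝ) :
    IsPreconnected (thickening δ P) := by
  rcases le_or_gt δ 0 with hδ | hδ
  · rw [thickening_of_nonpos hδ]; exact isPreconnected_empty
  rw [thickening_eq_biUnion_ball]
  rcases P.eq_empty_or_nonempty with rfl | ⟨p, hp⟩
  · simpa using! isPreconnected_empty
  have hsub : P ⊆ ⋃ x ∈ P, ball x δ := fun x hx => mem_biUnion hx (mem_ball_self hδ)
  refine isPreconnected_of_forall p fun y hy => ?_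
  obtain ⟨x, hx, hyx⟩ := mem_iUnion₂.mp hy
  exact ⟨P ∪ ball x δ, union_subset hsub (subset_biUnion_of_mem (u := fun x => ball x δ) hx),
    Or.inl hp, Or.inr hyx,
    hP.union x hx (mem_ball_self hδ) (convex_ball x δ).isPreconnected⟩

/-- On compact pieces of a domain with connected complement, a value omitted by an injective
open map has a continuous logarithm. -/
theorem hasContLog_sub_on_compact (hU : IsOpen U) (hUc : IsPreconnected U)
    (hUb : Bornology.IsBounded U) (hUk : IsPreconnected Uᶜ) (hf : DifferentiableOn ℂ f U)
    (hinj : InjOn f U) {a : ℂ} (ha : a ∉ f '' U) {ε : ℝ} (hε : 0 < ε) :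
    HasContLog {z | ε ≤ infDist z Uᶜ} (fun z => f z - a) := by
  have hne : (Uᶜ).Nonempty := by
    rw [nonempty_compl]
    rintro rfl
    exact NormedSpace.unbounded_univ ℝ ℂ hUb
  set X : Set ℂ := {z | ε ≤ infDist z Uᶜ} with hX
  have hXU : X ⊆ U := fun z hz => by
    by_contra hzU
    have : infDist z Uᶜ = 0 := infDist_zero_of_mem hzU
    exact absurd hz (by simp [hX, this, hε])
  have hXcl : IsClosed X := isClosed_le continuous_const (continuous_infDist_pt _)
  have hXcpt : IsCompact X := isCompact_of_isClosed_isBounded hXcl (hUb.subset hXU)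
  have hXc : Xᶜ = thickening ε Uᶜ := by
    ext z
    rw [mem_thickening_iff_infDist_lt hne, mem_compl_iff, hX, mem_ofPred_eq, not_le]
  -- The collar U ∖ X is connected by unicoherence: Xᶜ is a thickening of the connected set Uᶜ, and
  -- together with `U` it covers the plane.
  have hS : IsPreconnected (U ∩ Xᶜ) := by
    refine isPreconnected_inter_of_union_eq_univ hU hXcl.isOpen_compl hUc
      (hXc ▸ isPreconnected_thickening hUk ε) ?_
    rw [← compl_subset_iff_union]
    exact compl_subset_compl.mpr hXU
  have hK : IsCompact (f '' X) := hXcpt.image_of_continuousOn (hf.continuousOn.mono hXU)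
  have haK : a ∉ f '' X := fun h => ha (image_mono hXU h)
  suffices h : HasContLog (f '' X) (fun z => z - a) from
    h.comp (hf.continuousOn.mono hXU) (mapsTo_image f X)
  refine hasContLog_sub_of_not_isBounded hK fun hb => ?_
  have hopen : IsOpen (f '' U) := isOpen_image_of_injOn hU hf hinj subset_rfl hU
  set W := connectedComponentIn (f '' X)ᶜ a with hW
  have hWo : IsOpen W := hK.isClosed.isOpen_compl.connectedComponentIn
  have haW : a ∈ W := mem_connectedComponentIn haK
  have hfr : (frontier W).Nonempty := by
    rw [nonempty_iff_ne_empty, Ne, frontier_eq_empty_iff]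
    rintro (h | h)
    · exact (h ▸ haW : a ∈ (∅ : Set ℂ))
    · rw [h] at hb
      exact NormedSpace.unbounded_univ ℝ ℂ hb
  obtain ⟨k, hk⟩ := hfr
  have hkK := frontier_connectedComponentIn_subset hK.isClosed a hk
  obtain ⟨y, hyU, hyW⟩ := mem_closure_iff.mp (frontier_subset_closure hk) _ hopen
    (image_mono hXU hkK)
  have hdiff : ∀ v ∈ f '' U, v ∉ f '' X → v ∈ f '' (U ∩ Xᶜ) := by
    rintro _ ⟨z, hz, rfl⟩ hv
    exact ⟨z, ⟨hz, fun hzX => hv ⟨z, hzX, rfl⟩⟩, rfl⟩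
  have hsub : f '' (U ∩ Xᶜ) ⊆ (f '' X)ᶜ := by
    rintro _ ⟨z, hz, rfl⟩ ⟨x, hx, hxz⟩
    exact hz.2 (hinj (hXU hx) hz.1 hxz ▸ hx)
  -- The frontier of `W` meets f(X), so by openness of f(U) the component `W` meets the image of the
  -- collar and therefore contains all of it.
  have hSW : f '' (U ∩ Xᶜ) ⊆ W := by
    rw [hW, connectedComponentIn_eq hyW]
    exact (hS.image f (hf.continuousOn.mono inter_subset_left)).subset_connectedComponentIn
      (hdiff y hyU (connectedComponentIn_subset _ _ hyW)) hsub
  -- To the right of a rightmost point of f(X) the horizontal ray avoids f(X) and starts in the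
  -- image of the collar. So `W` contains the ray and is unbounded.
  obtain ⟨x, hx, hmax⟩ := hK.exists_isMaxOn ⟨k, hkK⟩ Complex.continuous_re.continuousOn
  obtain ⟨δ, hδ, hball⟩ := Metric.isOpen_iff.mp hopen x (image_mono hXU hx)
  have hray : ∀ t : ℝ, 0 < t → x + t ∉ f '' X := fun t ht h => by
    have := hmax h
    simp only [mem_ofPred_eq, Complex.add_re, Complex.ofReal_re] at this
    linarith
  have hmem : x + (δ / 2 : ℝ) ∈ W := hSW (hdiff _ (hball (by
    rw [mem_ball, dist_eq_norm, add_sub_cancel_left, Complex.norm_real, Real.norm_of_nonneg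
      (by positivity)]
    linarith)) (hray _ (by positivity)))
  have hrayW : (fun t : ℝ => x + t) '' Ioi 0 ⊆ W := by
    rw [hW, connectedComponentIn_eq hmem]
    refine (isPreconnected_Ioi.image _ (by fun_prop)).subset_connectedComponentIn
      ⟨δ / 2, by simpa using hδ, rfl⟩ ?_
    rintro _ ⟨t, ht, rfl⟩
    exact hray t ht
  obtain ⟨R, hR0, hR⟩ := hb.subset_ball_lt 0 x
  have := hR (hrayW ⟨R, hR0, rfl⟩)
  rw [mem_ball, dist_eq_norm, add_sub_cancel_left, Complex.norm_real, Real.norm_of_nonneg hR0.le]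
    at this
  exact lt_irrefl _ this

theorem exists_pos_le_infDist_path (hU : IsOpen U) (hne : (Uᶜ).Nonempty) (γ : C(unitInterval, U)) :
    ∃ ε > 0, ∀ t, ε ≤ infDist (γ t : ℂ) Uᶜ := by
  obtain ⟨t₀, -, ht₀⟩ := isCompact_univ.exists_isMinOn (univ_nonempty)
    (f := fun t => infDist (γ t : ℂ) Uᶜ)
    ((continuous_infDist_pt _).comp (continuous_subtype_val.comp γ.continuous)).continuousOn
  refine ⟨_, (hU.isClosed_compl.notMem_iff_infDist_pos hne).mp (not_not.mpr (γ t₀).2),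
    fun t => ht₀ (mem_univ t)⟩

/-- A nonvanishing function on a domain has a continuous logarithm if it has one on all compact
pieces. -/
theorem HasContLog.of_compact_pieces (hU : IsOpen U) (hUc : IsConnected U) (hne : (Uᶜ).Nonempty)
    {g : ℂ → ℂ} (hg : ContinuousOn g U) (hg0 : ∀ z ∈ U, g z ≠ 0)
    (h : ∀ ε > 0, HasContLog {z | ε ≤ infDist z Uᶜ} g) : HasContLog U g := by
  have : PathConnectedSpace U :=
    isPathConnected_iff_pathConnectedSpace.mp (hU.isConnected_iff_isPathConnected.mp hUc)
  have : LocallyPathConnectedSpace U := hU.locallyPathConnectedSpace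
  obtain ⟨x₀, hx₀⟩ := hUc.nonempty
  have hcov := Complex.isCoveringMap_exp
  let G : C(U, {z : ℂ // z ≠ 0}) := ⟨fun z => ⟨g z, hg0 z z.2⟩,
    (continuousOn_iff_continuous_domRestrict.mp hg).subtype_mk _⟩
  have hstart : (⟨Complex.exp (Complex.log (g x₀)), Complex.exp_ne_zero _⟩ : {z : ℂ // z ≠ 0}) =
      G ⟨x₀, hx₀⟩ := Subtype.ext (Complex.exp_log (hg0 x₀ hx₀))
  obtain ⟨F, ⟨-, hF⟩, -⟩ := hcov.isLocalHomeomorph.existsUnique_continuousMap_lifts G ⟨x₀, hx₀⟩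
    (Complex.log (g x₀)) hstart
    (fun γ hγ => by
      obtain ⟨Γ, hΓ, hΓ0⟩ := hcov.exists_path_lifts (G.comp γ) (Complex.log (g x₀))
        (by rw [ContinuousMap.comp_apply, hγ]; exact hstart.symm)
      exact ⟨Γ, hΓ0, hΓ⟩)
    -- Monodromy: two paths with the same ends lie in a common compact piece, and the logarithm
    -- given there determines the final value of both lifts.
    (fun γ γ' Γ Γ' hγ hγ' hΓ0 hΓ0' hΓ hΓ' h1 => by
      obtain ⟨ε, hε, hle⟩ := exists_pos_le_infDist_path hU hne γ
      obtain ⟨ε', hε', hle'⟩ := exists_pos_le_infDist_path hU hne γ'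
      obtain ⟨L, hL, hLg⟩ := h (min ε ε') (lt_min hε hε')
      have key : ∀ (β : C(unitInterval, U)) (B : C(unitInterval, ℂ)), β 0 = ⟨x₀, hx₀⟩ →
          B 0 = Complex.log (g x₀) → (∀ t, min ε ε' ≤ infDist (β t : ℂ) Uᶜ) →
          (fun z : ℂ => (⟨Complex.exp z, Complex.exp_ne_zero z⟩ : {z : ℂ // z ≠ 0})) ∘ B =
            G.comp β → B 1 = L (β 1) + (Complex.log (g x₀) - L x₀) := by
        intro β B hβ hB hβle hBβ
        obtain ⟨n, hn⟩ := HasContLog.exists_int_eq (K := (univ : Set unitInterval))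
          isPreconnected_univ B.continuous.continuousOn (M := fun t => L (β t))
          (hL.comp (continuous_subtype_val.comp β.continuous).continuousOn fun t _ => hβle t)
          fun t _ => by
            rw [hLg _ (hβle t)]
            exact congrArg Subtype.val (congrFun hBβ t)
        have h2 := hn 0 (mem_univ _)
        have h3 := hn 1 (mem_univ _)
        rw [hB, hβ] at h2
        simp only at h2 h3
        linear_combination h3 - h2
      rw [key γ Γ hγ hΓ0 (fun t => (min_le_left _ _).trans (hle t)) hΓ,
        key γ' Γ' hγ' hΓ0' (fun t => (min_le_right _ _).trans (hle' t)) hΓ', h1])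
  classical
  refine ⟨fun z => if hz : z ∈ U then F ⟨z, hz⟩ else 0, ?_, fun z hz => ?_⟩
  · rw [continuousOn_iff_continuous_domRestrict]
    convert! F.continuous using 1
    ext z
    simp
  · simp only [hz, dif_pos]
    exact congrArg Subtype.val (congrFun hF ⟨z, hz⟩)

theorem one_sub_conj_mul_ne_zero {a w : ℂ} (ha : ‖a‖ < 1) (hw : ‖w‖ < 1) : 1 - conj a * w ≠ 0 := by
  intro h
  have h1 : ‖conj a * w‖ = 1 := by rw [← sub_eq_zero.mp h, norm_one]
  rw [norm_mul, RCLike.norm_conj] at h1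
  nlinarith [norm_nonneg a, norm_nonneg w]

theorem norm_mobius_lt_one {a w : ℂ} (ha : ‖a‖ < 1) (hw : ‖w‖ < 1) :
    ‖(w - a) / (1 - conj a * w)‖ < 1 := by
  have h0 := one_sub_conj_mul_ne_zero ha hw
  rw [norm_div, div_lt_one (norm_pos_iff.mpr h0)]
  refine lt_of_pow_lt_pow_left₀ 2 (norm_nonneg _) ?_
  have h1 : ‖1 - conj a * w‖ ^ 2 - ‖w - a‖ ^ 2 = (1 - ‖a‖ ^ 2) * (1 - ‖w‖ ^ 2) := by
    simp only [← Complex.normSq_eq_norm_sq, Complex.normSq_apply, Complex.sub_re, Complex.sub_im,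
      Complex.mul_re, Complex.mul_im, Complex.one_re, Complex.one_im, Complex.conj_re,
      Complex.conj_im]
    ring
  have h2 : 0 < (1 - ‖a‖ ^ 2) * (1 - ‖w‖ ^ 2) :=
    mul_pos (by nlinarith [norm_nonneg a]) (by nlinarith [norm_nonneg w])
  linarith

theorem one_sub_conj_mul_self {a : ℂ} : 1 - conj a * a = ((1 - ‖a‖ ^ 2 : ℝ) : ℂ) := by
  rw [mul_comm, Complex.mul_conj, Complex.normSq_eq_norm_sq]
  push_cast
  ring

theorem mobius_injective {a w v : ℂ} (ha : ‖a‖ < 1) (hw : ‖w‖ < 1) (hv : ‖v‖ < 1)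
    (h : (w - a) / (1 - conj a * w) = (v - a) / (1 - conj a * v)) : w = v := by
  rw [div_eq_div_iff (one_sub_conj_mul_ne_zero ha hw) (one_sub_conj_mul_ne_zero ha hv)] at h
  have h1 : (w - v) * (1 - conj a * a) = 0 := by linear_combination h
  rcases mul_eq_zero.mp h1 with h2 | h2
  · exact sub_eq_zero.mp h2
  · exact absurd h2 (one_sub_conj_mul_ne_zero ha ha)

theorem HasDerivAt.mobius {a f' z : ℂ} (ha : ‖a‖ < 1) (hf : ‖f z‖ < 1) (h : HasDerivAt f f' z) :
    HasDerivAt (fun z => (f z - a) / (1 - conj a * f z))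
      ((1 - conj a * a) * f' / (1 - conj a * f z) ^ 2) z := by
  have h0 := one_sub_conj_mul_ne_zero ha hf
  refine ((h.sub_const a).fun_div ((h.const_mul (conj a)).const_sub 1) h0).congr_deriv ?_
  ring

/-- The holomorphic injections of a domain into the unit disk that fix the origin. -/
structure IsDiskInjection (U : Set ℂ) (f : ℂ → ℂ) : Prop where
  diff : DifferentiableOn ℂ f U
  injOn : InjOn f U
  mapsTo : MapsTo f U (ball 0 1)
  map_zero : f 0 = 0

/-- Koebe's square root trick. -/
theorem IsDiskInjection.exists_norm_deriv_lt (hf : IsDiskInjection U f) (hU : IsOpen U)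
    (hUc : IsConnected U) (hUb : Bornology.IsBounded U) (hUk : IsPreconnected Uᶜ)
    (h0 : (0 : ℂ) ∈ U) (hd : deriv f 0 ≠ 0) {a : ℂ} (ha : ‖a‖ < 1) (haf : a ∉ f '' U) :
    ∃ k, IsDiskInjection U k ∧ ‖deriv f 0‖ < ‖deriv k 0‖ := by
  have hne : (Uᶜ).Nonempty := by
    rw [nonempty_compl]
    rintro rfl
    exact NormedSpace.unbounded_univ ℝ ℂ hUb
  have hfn : ∀ z ∈ U, ‖f z‖ < 1 := fun z hz => mem_ball_zero_iff.mp (hf.mapsTo hz)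
  have hfa : ∀ z ∈ U, f z - a ≠ 0 := fun z hz h => haf ⟨z, hz, sub_eq_zero.mp h⟩
  have hden : ∀ z ∈ U, 1 - conj a * f z ≠ 0 := fun z hz => one_sub_conj_mul_ne_zero ha (hfn z hz)
  have hlog1 : HasContLog U (fun z => f z - a) :=
    HasContLog.of_compact_pieces hU hUc hne (hf.diff.continuousOn.sub continuousOn_const) hfa
      fun ε hε => hasContLog_sub_on_compact hU hUc.isPreconnected hUb hUk hf.diff hf.injOn haf hε
  have hlog2 : HasContLog U (fun z => 1 - conj a * f z) := by
    refine HasContLog.of_norm_sub_lt (c := 1)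
      (continuousOn_const.sub (continuousOn_const.mul hf.diff.continuousOn)) fun z hz => ?_
    rw [sub_sub_cancel_left, norm_neg, norm_mul, RCLike.norm_conj, norm_one]
    nlinarith [hfn z hz, norm_nonneg a, norm_nonneg (f z)]
  have hgderiv : ∀ z ∈ U, HasDerivAt (fun z => (f z - a) / (1 - conj a * f z))
      ((1 - conj a * a) * deriv f z / (1 - conj a * f z) ^ 2) z := fun z hz =>
    HasDerivAt.mobius ha (hfn z hz) (hf.diff.differentiableAt (hU.mem_nhds hz)).hasDerivAt
  obtain ⟨ℓ, hℓ, hexp⟩ := (hlog1.div hlog2).exists_differentiableOn hU fun z hz =>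
    (hgderiv z hz).differentiableAt.differentiableWithinAt
  -- `h` is a square root of `f` followed by the Möbius map taking the omitted value `a` to 0. A
  -- second Möbius map, taking h(0) = b to 0, gives the competitor.
  set h : ℂ → ℂ := fun z => Complex.exp (ℓ z / 2) with hh
  have hsq : ∀ z ∈ U, h z ^ 2 = (f z - a) / (1 - conj a * f z) := fun z hz => by
    rw [← hexp z hz, hh, ← Complex.exp_nat_mul]
    congr 1
    push_cast
    ring
  have hhd : DifferentiableOn ℂ h U := (hℓ.div_const 2).cexp
  have hhn : ∀ z ∈ U, ‖h z‖ < 1 := fun z hz => by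
    have h1 : ‖h z‖ ^ 2 < 1 := by
      rw [← norm_pow, hsq z hz]
      exact norm_mobius_lt_one ha (hfn z hz)
    nlinarith [norm_nonneg (h z)]
  have hb := hhn 0 h0
  set b := h 0 with hbdef
  have hb0 : b ≠ 0 := Complex.exp_ne_zero _
  have hkderiv : ∀ z ∈ U, HasDerivAt (fun z => (h z - b) / (1 - conj b * h z))
      ((1 - conj b * b) * deriv h z / (1 - conj b * h z) ^ 2) z := fun z hz =>
    HasDerivAt.mobius hb (hhn z hz) (hhd.differentiableAt (hU.mem_nhds hz)).hasDerivAt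
  refine ⟨fun z => (h z - b) / (1 - conj b * h z), ⟨?_, ?_, ?_, ?_⟩, ?_⟩
  · exact fun z hz => (hkderiv z hz).differentiableAt.differentiableWithinAt
  · intro z hz w hw hzw
    have h1 := mobius_injective hb (hhn z hz) (hhn w hw) hzw
    have h2 : (f z - a) / (1 - conj a * f z) = (f w - a) / (1 - conj a * f w) := by
      rw [← hsq z hz, ← hsq w hw, h1]
    exact hf.injOn hz hw (mobius_injective ha (hfn z hz) (hfn w hw) h2)
  · exact fun z hz => mem_ball_zero_iff.mpr (norm_mobius_lt_one hb (hhn z hz))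
  · simp [hbdef]
  · rw [(hkderiv 0 h0).deriv, ← hbdef]
    have hb2 : b ^ 2 = -a := by
      rw [hbdef, hsq 0 h0, hf.map_zero]
      simp
    have hder : 2 * b * deriv h 0 = (1 - conj a * a) * deriv f 0 := by
      have h1 := ((hhd.differentiableAt (hU.mem_nhds h0)).hasDerivAt.pow 2)
      have h2 : h ^ 2 =ᶠ[𝓝 0] fun z => (f z - a) / (1 - conj a * f z) := by
        filter_upwards [hU.mem_nhds h0] with z hz
        rw [← hsq z hz]
        rfl
      have h3 := (h1.congr_of_eventuallyEq h2.symm).unique (hgderiv 0 h0)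
      rw [hf.map_zero] at h3
      simpa using h3
    have hna : ‖a‖ = ‖b‖ ^ 2 := by rw [← norm_pow, hb2, norm_neg]
    have hbpos : 0 < ‖b‖ := norm_pos_iff.mpr hb0
    have hfpos : 0 < ‖deriv f 0‖ := norm_pos_iff.mpr hd
    have hc : 0 < 1 - ‖b‖ ^ 2 := by nlinarith
    have hder' : 2 * ‖b‖ * ‖deriv h 0‖ = (1 - ‖b‖ ^ 4) * ‖deriv f 0‖ := by
      have h1 := congrArg norm hder
      rw [one_sub_conj_mul_self, norm_mul, norm_mul, norm_mul, Complex.norm_real, hna,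
        Real.norm_of_nonneg (by nlinarith [mul_pos hc hc])] at h1
      rw [← pow_mul] at h1
      simpa using h1
    have hk : ‖(1 - conj b * b) * deriv h 0 / (1 - conj b * b) ^ 2‖ =
        ‖deriv h 0‖ / (1 - ‖b‖ ^ 2) := by
      rw [one_sub_conj_mul_self, norm_div, norm_mul, norm_pow, Complex.norm_real,
        Real.norm_of_nonneg hc.le]
      field_simp
    -- Since |a| = |b|², the derivative at 0 has grown by the factor (1 + |b|²)/(2|b|), which
    -- exceeds 1 because |b| < 1.
    rw [hk, lt_div_iff₀ hc]
    have h4 : 2 * ‖b‖ * ‖deriv h 0‖ = (1 + ‖b‖ ^ 2) * ((1 - ‖b‖ ^ 2) * ‖deriv f 0‖) := by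
      rw [hder']; ring
    have h5 : 2 * ‖b‖ < 1 + ‖b‖ ^ 2 := by nlinarith [sq_pos_of_pos (sub_pos.mpr hb)]
    have h6 : 0 < (1 - ‖b‖ ^ 2) * ‖deriv f 0‖ := by positivity
    nlinarith

/-- A Riemann map of the domain `U` together with its inverse. -/
structure IsRiemannPair (U : Set ℂ) (φ g : ℂ → ℂ) : Prop where
  diff : DifferentiableOn ℂ φ (ball 0 1)
  diff_inv : DifferentiableOn ℂ g U
  mapsTo : MapsTo φ (ball 0 1) U
  mapsTo_inv : MapsTo g U (ball 0 1)
  left_inv : ∀ z ∈ ball (0 : ℂ) 1, g (φ z) = z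
  right_inv : ∀ w ∈ U, φ (g w) = w
  map_zero : φ 0 = 0

/-- The Riemann mapping theorem for bounded domains with connected complement. -/
theorem exists_isRiemannPair (hU : IsOpen U) (hUc : IsConnected U) (hUb : Bornology.IsBounded U)
    (hUk : IsPreconnected Uᶜ) (h0 : (0 : ℂ) ∈ U) : ∃ φ g, IsRiemannPair U φ g := by
  obtain ⟨R, hR0, hR⟩ := hUb.subset_ball_lt 0 0
  obtain ⟨r, hr, hball⟩ := Metric.isOpen_iff.mp hU 0 h0
  have hscale : IsDiskInjection U (fun z => z / R) := by
    refine ⟨differentiableOn_id.div_const _, fun z _ w _ h => ?_, fun z hz => ?_, by simp⟩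
    · exact (div_left_inj' (Complex.ofReal_ne_zero.mpr hR0.ne')).mp h
    · rw [mem_ball_zero_iff, norm_div, Complex.norm_real, Real.norm_of_nonneg hR0.le,
        div_lt_one hR0]
      exact mem_ball_zero_iff.mp (hR hz)
  set S : Set ℝ := {x | ∃ f, IsDiskInjection U f ∧ ‖deriv f 0‖ = x} with hS
  have hSne : S.Nonempty := ⟨_, _, hscale, rfl⟩
  have hSb : BddAbove S := by
    refine ⟨1 / r, ?_⟩
    rintro _ ⟨f, hf, rfl⟩
    refine Complex.norm_deriv_le_div_of_mapsTo_ball (hf.diff.mono hball) ?_ hr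
    rw [hf.map_zero]
    exact fun z hz => ball_subset_closedBall (hf.mapsTo (hball hz))
  -- A positive supremum keeps the extremal limit from being constant, as Hurwitz's theorem
  -- requires.
  have hSpos : 0 < sSup S := by
    refine lt_of_lt_of_le ?_ (le_csSup hSb ⟨_, hscale, rfl⟩)
    rw [deriv_div_const, deriv_id'', norm_pos_iff]
    exact div_ne_zero one_ne_zero (Complex.ofReal_ne_zero.mpr hR0.ne')
  obtain ⟨u, -, hu, huS⟩ := exists_seq_tendsto_sSup hSne hSb
  choose F hF hFu using huS
  have hp : ((hyperfilter ℕ : Ultrafilter ℕ) : Filter ℕ) ≤ atTop := by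
    rw [← Nat.cofinite_eq_atTop]
    exact hyperfilter_le_cofinite
  obtain ⟨f, hfm, hlim⟩ := exists_tendstoLocallyUniformlyOn_ultrafilter (hyperfilter ℕ) hU
    (fun n => (hF n).diff) (fun n => (hF n).mapsTo)
  have hfd : DifferentiableOn ℂ f U :=
    hlim.differentiableOn (Eventually.of_forall fun n => (hF n).diff) hU
  have hderiv : ‖deriv f 0‖ = sSup S := by
    have h1 := ((hlim.deriv (Eventually.of_forall fun n => (hF n).diff) hU).tendsto_at h0).norm
    refine tendsto_nhds_unique h1 ((hu.mono_left hp).congr fun n => (hFu n).symm)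
  have hd0 : deriv f 0 ≠ 0 := norm_pos_iff.mp (hderiv ▸ hSpos)
  have hinj : InjOn f U := injOn_of_tendstoLocallyUniformlyOn hU hUc.isPreconnected hlim
    (fun n => (hF n).diff) (fun n => (hF n).injOn) h0 hd0
  have hopen := isOpen_image_of_injOn hU hfd hinj subset_rfl hU
  have hf : IsDiskInjection U f := by
    refine ⟨hfd, hinj, fun z hz => ?_, ?_⟩
    · have h1 : f '' U ⊆ interior (closedBall 0 1) :=
        interior_maximal hfm.image_subset hopen
      rw [interior_closedBall _ one_ne_zero] at h1
      exact h1 ⟨z, hz, rfl⟩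
    · refine tendsto_nhds_unique (hlim.tendsto_at h0) ?_
      simp_rw [(hF _).map_zero]
      exact tendsto_const_nhds
  have honto : f '' U = ball 0 1 := by
    refine subset_antisymm hf.mapsTo.image_subset fun a ha => ?_
    by_contra haf
    obtain ⟨k, hk, hlt⟩ := hf.exists_norm_deriv_lt hU hUc hUb hUk h0 hd0
      (mem_ball_zero_iff.mp ha) haf
    exact absurd (le_csSup hSb ⟨k, hk, rfl⟩) (not_le.mpr (hderiv ▸ hlt))
  obtain ⟨g, hg, hgf⟩ := exists_holomorphic_inverse hU hfd hinj
  rw [honto] at hg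
  have hex : ∀ z ∈ ball (0 : ℂ) 1, ∃ w ∈ U, f w = z := fun z hz => by
    rwa [← honto] at hz
  refine ⟨g, f, hg, hfd, ?_, hf.mapsTo, ?_, hgf, ?_⟩
  · intro z hz
    obtain ⟨w, hw, rfl⟩ := hex z hz
    rwa [hgf w hw]
  · intro z hz
    obtain ⟨w, hw, rfl⟩ := hex z hz
    rw [hgf w hw]
  · have := hgf 0 h0
    rwa [hf.map_zero] at this

end Riemann

end KnotTorus

namespace KnotTorus

/-! ### The length-area estimate and short crosscuts. -/

section LengthArea

open Set Metric Topology MeasureTheory Complex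

theorem det_smul_one_eq_norm_sq (c : ℂ) : (c • (1 : ℂ →L[ℝ] ℂ)).det = ‖c‖ ^ 2 := by
  have h : ((c • (1 : ℂ →L[ℝ] ℂ) : ℂ →L[ℝ] ℂ) : ℂ →ₗ[ℝ] ℂ) = Algebra.lmul ℝ ℂ c := by
    ext; simp
  rw [ContinuousLinearMap.det, h, ← Algebra.norm_apply, Algebra.norm_complex_apply,
    Complex.normSq_eq_norm_sq]

/-- The real Jacobian of a holomorphic map is |f'|², so the energy of an injective one is the area
of its image. -/
theorem lintegral_norm_deriv_sq {U : Set ℂ} {f : ℂ → ℂ} (hU : IsOpen U)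
    (hf : DifferentiableOn ℂ f U) (hinj : InjOn f U) :
    ∫⁻ z in U, ENNReal.ofReal (‖deriv f z‖ ^ 2) = volume (f '' U) := by
  rw [← lintegral_abs_det_fderiv_eq_addHaar_image volume hU.measurableSet
    (f' := fun z => deriv f z • (1 : ℂ →L[ℝ] ℂ)) (fun z hz =>
      ((hf.differentiableAt (hU.mem_nhds hz)).hasDerivAt.complexToReal_fderiv).hasFDerivWithinAt)
    hinj]
  simp_rw [det_smul_one_eq_norm_sq, abs_pow, abs_norm]

/-- The horizontal strip of points with imaginary part between `0` and `π`. -/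
def strip : Set ℂ := {w | 0 < w.im ∧ w.im < Real.pi}

theorem isOpen_strip : IsOpen strip :=
  (isOpen_lt continuous_const Complex.continuous_im).inter
    (isOpen_lt Complex.continuous_im continuous_const)

theorem lintegral_strip {h : ℂ → ENNReal} (hm : Measurable h) :
    ∫⁻ z in strip, h z = ∫⁻ x : ℝ, ∫⁻ y in Ioo 0 Real.pi, h (x + y * I) := by
  have hmi : Measurable (strip.indicator h) := hm.indicator isOpen_strip.measurableSet
  have he : ∀ p : ℝ × ℝ, Complex.measurableEquivRealProd.symm p = p.1 + p.2 * I := fun p => by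
    apply Complex.ext <;> simp [Complex.measurableEquivRealProd]
  rw [← lintegral_indicator isOpen_strip.measurableSet,
    ← (Complex.volume_preserving_equiv_real_prod.symm).lintegral_comp_emb
      Complex.measurableEquivRealProd.symm.measurableEmbedding, Measure.volume_eq_prod,
    lintegral_prod _ (by fun_prop)]
  refine lintegral_congr fun x => ?_
  rw [← lintegral_indicator measurableSet_Ioo]
  refine lintegral_congr fun y => ?_
  rw [he]
  by_cases hy : y ∈ Ioo 0 Real.pi
  · rw [indicator_of_mem hy, indicator_of_mem]
    simpa [strip] using hy
  · rw [indicator_of_notMem hy, indicator_of_notMem]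
    simpa [strip] using hy

/-- A long vertical segment in the image forces a lower bound for the energy. -/
theorem le_lintegral_of_lt_norm_sub {F : ℂ → ℂ} (hF : DifferentiableOn ℂ F strip) {ε : ℝ}
    (hε : 0 < ε) {s a b : ℝ} (ha : a ∈ Ioo 0 Real.pi) (hb : b ∈ Ioo 0 Real.pi) (hab : a ≤ b)
    (h : ε < ‖F (s + b * I) - F (s + a * I)‖) :
    ENNReal.ofReal (ε ^ 2 / Real.pi) ≤
      ∫⁻ y in Ioo 0 Real.pi, ENNReal.ofReal (‖deriv F (s + y * I)‖ ^ 2) := by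
  have hpi := Real.pi_pos
  have hmem : ∀ y ∈ Icc a b, (s + y * I : ℂ) ∈ strip := fun y hy => by
    simpa [strip] using ⟨ha.1.trans_le hy.1, hy.2.trans_lt hb.2⟩
  have hderiv : ∀ y ∈ uIcc a b,
      HasDerivAt (fun y : ℝ => F (s + y * I)) (deriv F (s + y * I) * I) y := fun y hy => by
    rw [uIcc_of_le hab] at hy
    have h1 := (hF.differentiableAt (isOpen_strip.mem_nhds (hmem y hy))).hasDerivAt
    have h2 : HasDerivAt (fun y : ℝ => (s + y * I : ℂ)) I y := by
      simpa using ((Complex.ofRealCLM.hasDerivAt (x := y)).mul_const I).const_add (s : ℂ)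
    exact h1.comp y h2
  have hcont : ContinuousOn (fun y : ℝ => deriv F (s + y * I)) (Icc a b) :=
    ((hF.deriv isOpen_strip).continuousOn).comp (by fun_prop) hmem
  have hcont' : ContinuousOn (fun y : ℝ => deriv F (s + y * I)) (uIcc a b) := by
    rwa [uIcc_of_le hab]
  have hint := intervalIntegral.integral_eq_sub_of_hasDerivAt hderiv
    (hcont'.mul continuousOn_const).intervalIntegrable
  have hsq : IntervalIntegrable (fun y : ℝ => ‖deriv F (s + y * I)‖ ^ 2) volume a b :=
    (hcont'.norm.pow 2).intervalIntegrable
  have hle : ε < ∫ y in a..b, ‖deriv F (s + y * I)‖ := by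
    rw [← hint] at h
    refine h.trans_le ((intervalIntegral.norm_integral_le_integral_norm hab).trans_eq ?_)
    simp
  -- Cauchy–Schwarz in the form x ≤ πx²/(2ε) + ε/(2π). The weights are chosen so that the constant
  -- term contributes at most ε/2 over a segment of length at most π.
  have hle2 : ∫ y in a..b, ‖deriv F (s + y * I)‖ ≤
      ∫ y in a..b, (Real.pi / (2 * ε) * ‖deriv F (s + y * I)‖ ^ 2 + ε / (2 * Real.pi)) := by
    refine intervalIntegral.integral_mono_on hab hcont'.norm.intervalIntegrable
      ((hsq.const_mul _).add intervalIntegrable_const) fun y _ => ?_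
    set x := ‖deriv F (s + y * I)‖
    have h1 : Real.pi / (2 * ε) * x ^ 2 + ε / (2 * Real.pi) - x =
        (Real.pi * x - ε) ^ 2 / (2 * Real.pi * ε) := by field_simp; ring
    have h2 : 0 ≤ (Real.pi * x - ε) ^ 2 / (2 * Real.pi * ε) := by positivity
    linarith
  rw [intervalIntegral.integral_add (hsq.const_mul _) intervalIntegrable_const,
    intervalIntegral.integral_const_mul, intervalIntegral.integral_const, smul_eq_mul] at hle2
  have hba : (b - a) * (ε / (2 * Real.pi)) ≤ ε / 2 := by
    have h1 : b - a ≤ Real.pi := by linarith [ha.1, hb.2]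
    calc (b - a) * (ε / (2 * Real.pi)) ≤ Real.pi * (ε / (2 * Real.pi)) := by gcongr
      _ = ε / 2 := by field_simp
  have hlow : ε ^ 2 / Real.pi ≤ ∫ y in a..b, ‖deriv F (s + y * I)‖ ^ 2 := by
    set A := ∫ y in a..b, ‖deriv F (s + y * I)‖ ^ 2
    have h1 : ε / 2 ≤ Real.pi / (2 * ε) * A := by linarith
    rw [div_mul_eq_mul_div, le_div_iff₀ (by positivity)] at h1
    rw [div_le_iff₀ hpi]
    nlinarith
  calc ENNReal.ofReal (ε ^ 2 / Real.pi)
      ≤ ENNReal.ofReal (∫ y in a..b, ‖deriv F (s + y * I)‖ ^ 2) := ENNReal.ofReal_le_ofReal hlow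
    _ = ∫⁻ y in Ioc a b, ENNReal.ofReal (‖deriv F (s + y * I)‖ ^ 2) := by
        rw [intervalIntegral.integral_of_le hab]
        exact ofReal_integral_eq_lintegral_ofReal hsq.1 (Filter.Eventually.of_forall fun _ =>
          sq_nonneg _)
    _ ≤ _ := lintegral_mono_set (show Ioc a b ⊆ Ioo 0 Real.pi from
        fun y hy => ⟨ha.1.trans hy.1, hy.2.trans_lt hb.2⟩)

/-- An injective holomorphic function of bounded image on the strip maps vertical segments
arbitrarily far to the left to sets of small diameter. -/
theorem exists_short_segment {F : ℂ → ℂ} (hF : DifferentiableOn ℂ F strip) (hinj : InjOn F strip)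
    (hb : Bornology.IsBounded (F '' strip)) {ε : ℝ} (hε : 0 < ε) (s₀ : ℝ) :
    ∃ s < s₀, ∀ a ∈ Ioo 0 Real.pi, ∀ b ∈ Ioo 0 Real.pi,
      ‖F (s + b * I) - F (s + a * I)‖ ≤ ε := by
  by_contra! hcon
  have hpi := Real.pi_pos
  have hlow : ∀ s < s₀, ENNReal.ofReal (ε ^ 2 / Real.pi) ≤
      ∫⁻ y in Ioo 0 Real.pi, ENNReal.ofReal (‖deriv F (s + y * I)‖ ^ 2) := fun s hs => by
    obtain ⟨a, ha, b, hb, hab⟩ := hcon s hs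
    rcases le_total a b with h | h
    · exact le_lintegral_of_lt_norm_sub hF hε ha hb h hab
    · exact le_lintegral_of_lt_norm_sub hF hε hb ha h (by rwa [norm_sub_rev])
  have hfin : ∫⁻ z in strip, ENNReal.ofReal (‖deriv F z‖ ^ 2) < ⊤ := by
    rw [lintegral_norm_deriv_sq isOpen_strip hF hinj]
    exact hb.measure_lt_top
  have hm : Measurable fun z => ENNReal.ofReal (‖deriv F z‖ ^ 2) :=
    ((measurable_deriv F).norm.pow_const 2).ennreal_ofReal
  rw [lintegral_strip hm] at hfin
  refine hfin.not_ge ?_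
  -- A fixed positive energy on every vertical line left of `s₀` would add up to infinite area.
  calc (⊤ : ENNReal) = ∫⁻ _ in Iio s₀, ENNReal.ofReal (ε ^ 2 / Real.pi) := by
        rw [setLIntegral_const, Real.volume_Iio, ENNReal.mul_top]
        exact (ENNReal.ofReal_pos.mpr (by positivity)).ne'
    _ ≤ ∫⁻ x in Iio s₀, ∫⁻ y in Ioo 0 Real.pi, ENNReal.ofReal (‖deriv F (x + y * I)‖ ^ 2) :=
        setLIntegral_mono' measurableSet_Iio fun x hx => hlow x hx
    _ ≤ _ := setLIntegral_le_lintegral _ _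

/-- The conformal map from the strip to the unit disk that sends the left end to `ζ`. -/
noncomputable def stripMap (ζ w : ℂ) : ℂ := ζ * (1 + I * Complex.exp w) / (1 - I * Complex.exp w)

theorem im_exp_pos {w : ℂ} (hw : w ∈ strip) : 0 < (Complex.exp w).im := by
  rw [Complex.exp_im]
  exact mul_pos (Real.exp_pos _) (Real.sin_pos_of_pos_of_lt_pi hw.1 hw.2)

theorem one_sub_I_mul_exp_ne_zero {w : ℂ} (hw : w ∈ strip) : 1 - I * Complex.exp w ≠ 0 := by
  intro h
  have h1 := congrArg Complex.re h
  simp at h1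
  linarith [im_exp_pos hw]

variable {ζ : ℂ}

theorem stripMap_mem_ball (hζ : ‖ζ‖ = 1) {w : ℂ} (hw : w ∈ strip) : stripMap ζ w ∈ ball 0 1 := by
  have h0 := one_sub_I_mul_exp_ne_zero hw
  rw [mem_ball_zero_iff, stripMap, norm_div, norm_mul, hζ, one_mul,
    div_lt_one (norm_pos_iff.mpr h0)]
  refine lt_of_pow_lt_pow_left₀ 2 (norm_nonneg _) ?_
  have := im_exp_pos hw
  simp only [← Complex.normSq_eq_norm_sq, Complex.normSq_apply, Complex.sub_re, Complex.sub_im,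
    Complex.add_re, Complex.add_im, Complex.mul_re, Complex.mul_im, Complex.one_re,
    Complex.one_im, Complex.I_re, Complex.I_im]
  nlinarith

theorem differentiableOn_stripMap : DifferentiableOn ℂ (stripMap ζ) strip := by
  have h : Differentiable ℂ fun w => I * Complex.exp w := by fun_prop
  exact (((h.const_add 1).const_mul ζ).differentiableOn).div (h.const_sub 1).differentiableOn
    fun w hw => one_sub_I_mul_exp_ne_zero hw

theorem injOn_stripMap (hζ : ‖ζ‖ = 1) : InjOn (stripMap ζ) strip := by
  intro w hw v hv h
  have hζ0 : ζ ≠ 0 := norm_ne_zero_iff.mp (by rw [hζ]; exact one_ne_zero)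
  rw [stripMap, stripMap, div_eq_div_iff (one_sub_I_mul_exp_ne_zero hw)
    (one_sub_I_mul_exp_ne_zero hv)] at h
  have h1 : ζ * I * 2 * (Complex.exp w - Complex.exp v) = 0 := by linear_combination h
  have h2 : Complex.exp w = Complex.exp v := by
    simpa [hζ0, sub_eq_zero] using h1
  refine Complex.exp_inj_of_neg_pi_lt_of_le_pi ?_ hw.2.le ?_ hv.2.le h2
  · linarith [hw.1, Real.pi_pos]
  · linarith [hv.1, Real.pi_pos]

/-- Vertical segments of the strip go to arcs of the Apollonius circles of ζ and -ζ. This is why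
crosscuts are described below by the ratio |z - ζ| / |z + ζ|. -/
theorem norm_stripMap_sub (hζ : ‖ζ‖ = 1) {w : ℂ} (hw : w ∈ strip) :
    ‖stripMap ζ w - ζ‖ = Real.exp w.re * ‖stripMap ζ w + ζ‖ := by
  have h0 := one_sub_I_mul_exp_ne_zero hw
  have h1 : stripMap ζ w - ζ = 2 * I * Complex.exp w * ζ / (1 - I * Complex.exp w) := by
    rw [stripMap]; field_simp; ring
  have h2 : stripMap ζ w + ζ = 2 * ζ / (1 - I * Complex.exp w) := by
    rw [stripMap]; field_simp; ring
  rw [h1, h2]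
  simp only [norm_div, norm_mul, Complex.norm_I, Complex.norm_exp, hζ]
  ring

theorem exists_stripMap_eq (hζ : ‖ζ‖ = 1) {z : ℂ} (hz : z ∈ ball (0 : ℂ) 1) :
    ∃ w ∈ strip, stripMap ζ w = z := by
  have hζ0 : ζ ≠ 0 := norm_ne_zero_iff.mp (by rw [hζ]; exact one_ne_zero)
  set y := z / ζ with hy
  have hyn : ‖y‖ < 1 := by rw [hy, norm_div, hζ, div_one]; exact mem_ball_zero_iff.mp hz
  have hy1 : y + 1 ≠ 0 := fun h => by
    rw [eq_neg_of_add_eq_zero_left h, norm_neg, norm_one] at hyn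
    exact lt_irrefl _ hyn
  set u := -I * ((y - 1) / (y + 1)) with hu
  have hIu : I * u = (y - 1) / (y + 1) := by
    rw [hu, ← mul_assoc, mul_neg, Complex.I_mul_I, neg_neg, one_mul]
  have huim : 0 < u.im := by
    have h1 : u.im = (1 - Complex.normSq y) / Complex.normSq (y + 1) := by
      rw [hu]
      simp [Complex.div_re, Complex.normSq_apply]
      ring
    rw [h1]
    refine div_pos ?_ (Complex.normSq_pos.mpr hy1)
    rw [Complex.normSq_eq_norm_sq]
    nlinarith [norm_nonneg y]
  have hu0 : u ≠ 0 := fun h => by rw [h] at huim; exact lt_irrefl _ huim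
  have hexp := Complex.exp_log hu0
  refine ⟨Complex.log u, ?_, ?_⟩
  · rw [strip, mem_ofPred_eq, Complex.log_im]
    have hsin : 0 < Real.sin u.arg := by
      rw [Complex.sin_arg]
      exact div_pos huim (norm_pos_iff.mpr hu0)
    constructor
    · by_contra! h
      exact absurd hsin (not_lt.mpr
        (Real.sin_nonpos_of_nonpos_of_neg_pi_le h (Complex.neg_pi_lt_arg u).le))
    · refine lt_of_le_of_ne (Complex.arg_le_pi u) fun h => ?_
      rw [h, Real.sin_pi] at hsin
      exact lt_irrefl _ hsin
  · rw [stripMap, hexp, hIu]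
    have h2 : 1 - (y - 1) / (y + 1) = 2 / (y + 1) := by field_simp; ring
    have h3 : 1 + (y - 1) / (y + 1) = 2 * y / (y + 1) := by field_simp; ring
    rw [h2, h3, hy]
    rw [← hy]
    field_simp
    rw [hy]
    field_simp

/-- Riemann maps of bounded domains map suitable circular crosscuts near a boundary point to sets
of small diameter. -/
theorem IsRiemannPair.exists_short_crosscut {U : Set ℂ} {φ g : ℂ → ℂ} (h : IsRiemannPair U φ g)
    (hUb : Bornology.IsBounded U) (hζ : ‖ζ‖ = 1) {ε : ℝ} (hε : 0 < ε) {r₀ : ℝ} (hr₀ : 0 < r₀) :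
    ∃ r, 0 < r ∧ r < r₀ ∧ ∀ z ∈ ball (0 : ℂ) 1, ∀ z' ∈ ball (0 : ℂ) 1,
      ‖z - ζ‖ = r * ‖z + ζ‖ → ‖z' - ζ‖ = r * ‖z' + ζ‖ → dist (φ z) (φ z') ≤ ε := by
  have hmaps : MapsTo (stripMap ζ) strip (ball 0 1) := fun w hw => stripMap_mem_ball hζ hw
  have hφinj : InjOn φ (ball 0 1) := fun z hz w hw hzw => by
    rw [← h.left_inv z hz, hzw, h.left_inv w hw]
  obtain ⟨s, hs, hseg⟩ := exists_short_segment (F := fun w => φ (stripMap ζ w))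
    (h.diff.comp differentiableOn_stripMap hmaps) (hφinj.comp (injOn_stripMap hζ) hmaps)
    (hUb.subset (by
      rintro _ ⟨w, hw, rfl⟩
      exact h.mapsTo (hmaps hw))) hε (Real.log r₀)
  refine ⟨Real.exp s, Real.exp_pos s, ?_, ?_⟩
  · rw [← Real.exp_log hr₀]
    exact Real.exp_lt_exp.mpr hs
  · have key : ∀ z ∈ ball (0 : ℂ) 1, ‖z - ζ‖ = Real.exp s * ‖z + ζ‖ →
        ∃ a ∈ Ioo 0 Real.pi, stripMap ζ (s + a * I) = z := by
      intro z hz hzs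
      obtain ⟨w, hw, rfl⟩ := exists_stripMap_eq hζ hz
      rw [norm_stripMap_sub hζ hw] at hzs
      have h0 : ‖stripMap ζ w + ζ‖ ≠ 0 := by
        rw [norm_ne_zero_iff]
        intro h0
        rw [eq_neg_of_add_eq_zero_left h0, mem_ball_zero_iff, norm_neg, hζ] at hz
        exact lt_irrefl _ hz
      have h1 := Real.exp_injective (mul_right_cancel₀ h0 hzs)
      refine ⟨w.im, hw, ?_⟩
      rw [← h1, Complex.re_add_im]
    intro z hz z' hz' hzs hzs'
    obtain ⟨a, ha, rfl⟩ := key z hz hzs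
    obtain ⟨b, hb, rfl⟩ := key z' hz' hzs'
    rw [dist_eq_norm]
    exact hseg b hb a ha

end LengthArea

end KnotTorus

namespace KnotTorus

/-! ### Continuous extension of the Riemann map to the closed disk. -/

section Caratheodory

open Set Metric Topology Filter

theorem circle_dist_eq_norm (t u : Circle) : dist t u = ‖(t : ℂ) - u‖ := by
  rw [← dist_eq_norm]; rfl

/-- The arcs are all rotations of a single one, the image of a symmetric interval of angles, so `ρ`
does not depend on `t`. -/
theorem exists_isPreconnected_subset_ball_circle {δ : ℝ} (hδ : 0 < δ) :
    ∃ ρ > 0, ∀ t : Circle, ∃ A : Set Circle, IsCompact A ∧ IsPreconnected A ∧ ball t ρ ⊆ A ∧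
      A ⊆ ball t δ := by
  obtain ⟨a, ha, hexp⟩ := Metric.continuous_iff.mp Circle.exp.continuous 0 δ hδ
  have harg : ContinuousAt (fun t : Circle => Complex.arg t) 1 :=
    (Complex.continuousAt_arg (by simp)).comp continuous_subtype_val.continuousAt
  obtain ⟨ρ, hρ, hargρ⟩ := Metric.continuousAt_iff.mp harg (a / 2) (by positivity)
  refine ⟨ρ, hρ, fun t => ⟨(fun s : ℝ => t * Circle.exp s) '' Icc (-(a / 2)) (a / 2), ?_, ?_, ?_,
    ?_⟩⟩
  · exact isCompact_Icc.image (by fun_prop)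
  · exact isPreconnected_Icc.image _ (by fun_prop)
  · intro u hu
    have h1 : dist (t⁻¹ * u) 1 < ρ := by
      have := mem_ball.mp hu
      rw [circle_dist_eq_norm] at this ⊢
      have h2 : ((t⁻¹ * u : Circle) : ℂ) - (1 : Circle) = ((t⁻¹ : Circle) : ℂ) * (u - t) := by
        rw [mul_sub, ← Circle.coe_mul, ← Circle.coe_mul, inv_mul_cancel]
      rw [h2, norm_mul, Circle.norm_coe, one_mul]
      exact this
    have h2 := hargρ h1
    simp only [Circle.coe_one, Complex.arg_one, Real.dist_eq, sub_zero] at h2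
    refine ⟨Complex.arg (t⁻¹ * u : Circle), ?_, ?_⟩
    · exact ⟨(abs_lt.mp h2).1.le, (abs_lt.mp h2).2.le⟩
    · simp only [Circle.exp_arg, mul_inv_cancel_left]
  · rintro _ ⟨s, hs, rfl⟩
    have h1 := hexp s (by
      rw [Real.dist_eq, sub_zero]
      exact (abs_le.mpr hs).trans_lt (by linarith))
    rw [mem_ball, circle_dist_eq_norm]
    rw [circle_dist_eq_norm, Circle.exp_zero] at h1
    have h2 : ((t * Circle.exp s : Circle) : ℂ) - t = t * (Circle.exp s - (1 : Circle)) := by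
      rw [mul_sub, ← Circle.coe_mul, ← Circle.coe_mul, mul_one]
    rw [h2, norm_mul, Circle.norm_coe, one_mul]
    exact h1

/-- Sets of small diameter on a Jordan curve lie in small arcs. -/
theorem exists_small_arc {J : Circle → ℂ} (hJ : Continuous J) (hinj : Function.Injective J)
    {ε : ℝ} (hε : 0 < ε) : ∃ δ > 0, ∀ T ⊆ range J, (∀ x ∈ T, ∀ y ∈ T, dist x y < δ) →
      ∃ B ⊆ range J, IsCompact B ∧ IsPreconnected B ∧ T ⊆ B ∧ ∀ x ∈ B, ∃ y ∈ T, dist x y < ε := by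
  obtain ⟨δ₁, hδ₁, hJu⟩ := Metric.uniformContinuous_iff.mp
    (CompactSpace.uniformContinuous_of_continuous hJ) ε hε
  obtain ⟨ρ, hρ, harc⟩ := exists_isPreconnected_subset_ball_circle hδ₁
  have hemb : IsClosedEmbedding J := hJ.isClosedEmbedding hinj
  have hinv : ∃ δ > 0, ∀ t u, dist (J t) (J u) < δ → dist t u < ρ := by
    set P : Set (Circle × Circle) := {p | ρ ≤ dist p.1 p.2}
    by_cases hne : P.Nonempty
    · have hcpt : IsCompact P :=
        (isClosed_le continuous_const continuous_dist).isCompact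
      obtain ⟨p, hp, hmin⟩ := hcpt.exists_isMinOn hne
        (f := fun p => dist (J p.1) (J p.2)) (by fun_prop)
      refine ⟨dist (J p.1) (J p.2), dist_pos.mpr fun h => ?_, fun t u h => ?_⟩
      · have h1 : ρ ≤ dist p.1 p.2 := hp
        rw [hinj h, dist_self] at h1
        exact absurd h1 (not_le.mpr hρ)
      · by_contra! hcon
        exact absurd h (not_lt.mpr (hmin (show (t, u) ∈ P from hcon)))
    · refine ⟨1, one_pos, fun t u _ => ?_⟩
      by_contra! hcon
      exact hne ⟨(t, u), hcon⟩
  obtain ⟨δ, hδ, hinv⟩ := hinv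
  refine ⟨δ, hδ, fun T hT hdiam => ?_⟩
  rcases T.eq_empty_or_nonempty with rfl | ⟨x, hx⟩
  · exact ⟨∅, empty_subset _, isCompact_empty, isPreconnected_empty, subset_rfl, by simp⟩
  obtain ⟨t, rfl⟩ := hT hx
  obtain ⟨A, hA, hAc, hAρ, hAδ⟩ := harc t
  refine ⟨J '' A, image_subset_range _ _, hA.image hJ, hAc.image _ hJ.continuousOn, ?_, ?_⟩
  · intro y hy
    obtain ⟨u, rfl⟩ := hT hy
    exact ⟨u, hAρ (hinv u t (hdiam _ hy _ hx)), rfl⟩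
  · rintro _ ⟨u, hu, rfl⟩
    exact ⟨J t, hx, hJu (hAδ hu)⟩

variable {U : Set ℂ} {φ g : ℂ → ℂ}

theorem IsRiemannPair.injOn (h : IsRiemannPair U φ g) : InjOn φ (ball 0 1) :=
  fun z hz w hw hzw => by rw [← h.left_inv z hz, hzw, h.left_inv w hw]

theorem IsRiemannPair.isOpen_image (h : IsRiemannPair U φ g) {V : Set ℂ} (hV : IsOpen V)
    (hVb : V ⊆ ball 0 1) : IsOpen (φ '' V) :=
  isOpen_image_of_injOn isOpen_ball h.diff h.injOn hVb hV

theorem IsRiemannPair.mem_closure_of_mem_closure_image (h : IsRiemannPair U φ g) (hU : IsOpen U)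
    {V : Set ℂ} (hVb : V ⊆ ball 0 1) {z : ℂ} (hz : z ∈ U) (hzV : z ∈ closure (φ '' V)) :
    g z ∈ closure V := by
  have h1 := mem_closure_image ((h.diff_inv.differentiableAt (hU.mem_nhds hz)).continuousAt) hzV
  rwa [image_image, image_congr fun v hv => h.left_inv v (hVb hv), image_id'] at h1

variable {J : Circle → ℂ}

/-- A short crosscut `X` near ζ has an image with small closure `C`, and C ∩ J lies in a small arc
`B` of `J`, so C ∪ B fits in a small ball about a point `c`. The image `V` of the side `D` cut off
at ζ has its frontier in J ∪ C. A point `w` of `V` outside the ball could not be told from 0 by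
winding: (z - w)/z has a logarithm on `J`, since both points lie in `U`, and on C ∪ B, since both
lie outside the ball. These glue along `B`, contradicting Borsuk's criterion for `V`. -/
theorem IsRiemannPair.exists_small_image (h : IsRiemannPair U φ g) (hU : IsOpen U)
    (hUc : IsPreconnected U) (hUb : Bornology.IsBounded U) (hJ : Continuous J)
    (hinj : Function.Injective J) (hfr : frontier U ⊆ range J) (hdisj : Disjoint U (range J))
    {ζ : ℂ} (hζ : ‖ζ‖ = 1) {ε : ℝ} (hε : 0 < ε) :
    ∃ r > 0, ∀ z ∈ ball (0 : ℂ) 1, ∀ z' ∈ ball (0 : ℂ) 1,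
      ‖z - ζ‖ < r * ‖z + ζ‖ → ‖z' - ζ‖ < r * ‖z' + ζ‖ → dist (φ z) (φ z') < ε := by
  have h00 : (0 : ℂ) ∈ U := by
    have := h.mapsTo (mem_ball_self one_pos)
    rwa [h.map_zero] at this
  have hg0 : g 0 = 0 := by
    have := h.left_inv 0 (mem_ball_self one_pos)
    rwa [h.map_zero] at this
  obtain ⟨ρ, hρ, hρg⟩ := Metric.continuousAt_iff.mp
    (h.diff_inv.differentiableAt (hU.mem_nhds h00)).continuousAt (1 / 2) (by norm_num)
  set ε' := min ε ρ with hε'def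
  have hε' : 0 < ε' := lt_min hε hρ
  obtain ⟨δ, hδ, harc⟩ := exists_small_arc hJ hinj (show 0 < ε' / 4 by positivity)
  -- A ratio below 1/3 keeps the crosscut outside the disk of radius 1/2, so by the choice of `ρ`
  -- its image has distance at least `ρ` from 0.
  obtain ⟨r, hr, hr3, hcross⟩ := h.exists_short_crosscut hUb hζ
    (show 0 < min (δ / 2) (ε' / 4) by positivity) (show (0 : ℝ) < 1 / 3 by norm_num)
  set X : Set ℂ := {z | z ∈ ball (0 : ℂ) 1 ∧ ‖z - ζ‖ = r * ‖z + ζ‖} with hX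
  set D : Set ℂ := {z | z ∈ ball (0 : ℂ) 1 ∧ ‖z - ζ‖ < r * ‖z + ζ‖} with hD
  have hDb : D ⊆ ball 0 1 := fun z hz => hz.1
  have hDo : IsOpen D := isOpen_ball.inter
    (isOpen_lt (f := fun z => ‖z - ζ‖) (g := fun z => r * ‖z + ζ‖) (by fun_prop) (by fun_prop))
  have hDcl : closure D ⊆ {z | ‖z - ζ‖ ≤ r * ‖z + ζ‖} :=
    closure_minimal (fun z hz => hz.2.le) (isClosed_le (by fun_prop) (by fun_prop))
  set V := φ '' D with hV
  have hVo : IsOpen V := h.isOpen_image hDo hDb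
  have hVU : V ⊆ U := by
    rintro _ ⟨z, hz, rfl⟩
    exact h.mapsTo (hDb hz)
  set C := closure (φ '' X) with hC
  have hbX : Bornology.IsBounded (φ '' X) := hUb.subset (by
    rintro _ ⟨z, hz, rfl⟩
    exact h.mapsTo hz.1)
  have hCdist : ∀ x ∈ C, ∀ y ∈ C, dist x y ≤ min (δ / 2) (ε' / 4) := fun x hx y hy => by
    refine (dist_le_diam_of_mem hbX.closure hx hy).trans ?_
    rw [diam_closure]
    refine diam_le_of_forall_dist_le (by positivity) ?_
    rintro _ ⟨z, hz, rfl⟩ _ ⟨w, hw, rfl⟩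
    exact hcross z hz.1 w hw.1 hz.2 hw.2
  have hfrV : frontier V ⊆ range J ∪ C := by
    intro z hz
    rw [hVo.frontier_eq] at hz
    by_cases hzU : z ∈ U
    · have h1 := hDcl (h.mem_closure_of_mem_closure_image hU hDb hzU hz.1)
      right
      have h2 : g z ∈ ball (0 : ℂ) 1 := h.mapsTo_inv hzU
      rcases lt_or_eq_of_le (show ‖g z - ζ‖ ≤ r * ‖g z + ζ‖ from h1) with h3 | h3
      · exact absurd ⟨g z, ⟨h2, h3⟩, h.right_inv z hzU⟩ hz.2
      · exact subset_closure ⟨g z, ⟨h2, h3⟩, h.right_inv z hzU⟩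
    · left
      apply hfr
      rw [hU.frontier_eq]
      exact ⟨closure_mono hVU hz.1, hzU⟩
  obtain ⟨B, hBJ, hBc, hBp, hTB, hB⟩ := harc (C ∩ range J) inter_subset_right
    fun x hx y hy => (hCdist x hx.1 y hy.1).trans_lt ((min_le_left _ _).trans_lt (by linarith))
  have hXne : ζ * ((1 - r) / (1 + r) : ℝ) ∈ X := by
    have h1r : (1 + r : ℂ) ≠ 0 := by
      have : (1 + r : ℝ) ≠ 0 := by positivity
      exact_mod_cast this
    refine ⟨?_, ?_⟩
    · rw [mem_ball_zero_iff, norm_mul, hζ, one_mul, Complex.norm_real, Real.norm_of_nonneg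
        (div_nonneg (by linarith) (by positivity)), div_lt_one (by positivity)]
      linarith
    · have h1 : ζ * ((1 - r) / (1 + r) : ℝ) - ζ = -(r * (2 * ζ / (1 + r))) := by
        push_cast; field_simp; ring
      have h2 : ζ * ((1 - r) / (1 + r) : ℝ) + ζ = 2 * ζ / (1 + r) := by
        push_cast; field_simp; ring
      rw [h1, h2, norm_neg, norm_mul, Complex.norm_real, Real.norm_of_nonneg hr.le]
  set c := φ (ζ * ((1 - r) / (1 + r) : ℝ)) with hc
  have hcC : c ∈ C := subset_closure ⟨_, hXne, rfl⟩
  have hcnorm : ρ ≤ ‖c‖ := by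
    by_contra! hlt
    have h1 := hρg (show dist c 0 < ρ by rwa [dist_zero_right])
    rw [hg0, hc, h.left_inv _ hXne.1, dist_zero_right] at h1
    have h2 := hXne.2
    set y := ζ * ((1 - r) / (1 + r) : ℝ) with hy
    have h3 : 1 - ‖y‖ ≤ ‖y - ζ‖ := by
      rw [← hζ, norm_sub_rev]; exact norm_sub_norm_le _ _
    have h4 : ‖y + ζ‖ ≤ ‖y‖ + 1 := by rw [← hζ]; exact norm_add_le _ _
    nlinarith [norm_nonneg y, norm_nonneg (y + ζ)]
  have hCB : C ∪ B ⊆ ball c (ε' / 2) := by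
    rintro x (hx | hx)
    · have := (hCdist x hx c hcC).trans (min_le_right _ _)
      rw [mem_ball]; linarith
    · obtain ⟨y, hy, hxy⟩ := hB x hx
      have := (hCdist y hy.1 c hcC).trans (min_le_right _ _)
      rw [mem_ball]
      linarith [dist_triangle x y c]
  have h0V : (0 : ℂ) ∉ closure V := fun h0 => by
    have := hDcl (h.mem_closure_of_mem_closure_image hU hDb h00 h0)
    rw [hg0, mem_ofPred_eq, zero_sub, zero_add, norm_neg, hζ] at this
    linarith
  have hVc : V ⊆ ball c (ε' / 2) := by
    intro w hw
    by_contra hwc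
    have hlog : ∀ v, v ∉ ball c (ε' / 2) → HasContLog (C ∪ B) (fun z => z - v) := fun v hv =>
      HasContLog.of_norm_sub_lt (c := c - v) (by fun_prop) fun z hz => by
        rw [sub_sub_sub_cancel_right, ← dist_eq_norm, ← dist_eq_norm, dist_comm c v]
        exact (mem_ball.mp (hCB hz)).trans_le (not_lt.mp hv)
    have h0c : (0 : ℂ) ∉ ball c (ε' / 2) := by
      rw [mem_ball, dist_zero_left, not_lt]
      have := min_le_right ε ρ
      linarith
    have hCcl : IsClosed (C ∪ B) := isClosed_closure.union hBc.isClosed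
    have hJcl : IsClosed (range J) := (isCompact_range hJ).isClosed
    have hinter : range J ∩ (C ∪ B) = B := by
      ext x
      constructor
      · rintro ⟨hx, hx' | hx'⟩
        · exact hTB ⟨hx', hx⟩
        · exact hx'
      · exact fun hx => ⟨hBJ hx, Or.inr hx⟩
    have hglue := HasContLog.union hJcl hCcl (hinter.symm ▸ hBp)
      (hasContLog_sub_div_sub hJcl hUc hdisj (hVU hw) h00)
      ((hlog w hwc).div (hlog 0 h0c))
    exact not_hasContLog_frontier (hUb.subset hVU) hw (u := fun z => z - 0) (by fun_prop)
      (fun z hz h0 => h0V (by rw [sub_zero] at h0; exact h0 ▸ hz))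
      (hglue.mono (hfrV.trans (union_subset_union_right _ subset_union_left)))
  refine ⟨r, hr, fun z hz z' hz' hzr hzr' => ?_⟩
  have h1 := mem_ball.mp (hVc ⟨z, ⟨hz, hzr⟩, rfl⟩)
  have h2 := mem_ball.mp (hVc ⟨z', ⟨hz', hzr'⟩, rfl⟩)
  have := min_le_left ε ρ
  linarith [dist_triangle_right (φ z) (φ z') c]

/-- Carathéodory: the Riemann map of a Jordan domain extends continuously to the closed disk. -/
theorem IsRiemannPair.exists_continuousOn_extension (h : IsRiemannPair U φ g) (hU : IsOpen U)
    (hUc : IsPreconnected U) (hUb : Bornology.IsBounded U) (hJ : Continuous J)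
    (hinj : Function.Injective J) (hfr : frontier U ⊆ range J) (hdisj : Disjoint U (range J)) :
    ∃ Φ : ℂ → ℂ, ContinuousOn Φ (closedBall 0 1) ∧ EqOn Φ φ (ball 0 1) ∧
      MapsTo Φ (sphere 0 1) (range J) := by
  have hcl : closure (ball (0 : ℂ) 1) = closedBall 0 1 := closure_ball 0 one_ne_zero
  have hlim : ∀ ζ ∈ closedBall (0 : ℂ) 1, ∃ y, Tendsto φ (𝓝[ball 0 1] ζ) (𝓝 y) := by
    intro ζ hζ
    have hne : (𝓝[ball 0 1] ζ).NeBot := mem_closure_iff_nhdsWithin_neBot.mp (hcl ▸ hζ)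
    by_cases hζb : ζ ∈ ball (0 : ℂ) 1
    · exact ⟨_, h.diff.continuousOn ζ hζb⟩
    have hζ1 : ‖ζ‖ = 1 := by
      rw [mem_closedBall_zero_iff] at hζ
      rw [mem_ball_zero_iff, not_lt] at hζb
      exact le_antisymm hζ hζb
    refine CompleteSpace.complete (f := map φ (𝓝[ball 0 1] ζ)) ?_
    rw [Metric.cauchy_iff]
    refine ⟨hne.map φ, fun ε hε => ?_⟩
    obtain ⟨r, hr, hsmall⟩ := h.exists_small_image hU hUc hUb hJ hinj hfr hdisj hζ1 hε
    refine ⟨φ '' {z | z ∈ ball (0 : ℂ) 1 ∧ ‖z - ζ‖ < r * ‖z + ζ‖}, image_mem_map ?_, ?_⟩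
    · refine inter_mem self_mem_nhdsWithin (mem_nhdsWithin_of_mem_nhds ?_)
      refine (isOpen_lt (f := fun z => ‖z - ζ‖) (g := fun z => r * ‖z + ζ‖) (by fun_prop)
        (by fun_prop)).mem_nhds ?_
      rw [mem_ofPred_eq, sub_self, norm_zero, ← two_mul, norm_mul, hζ1]
      simpa using hr
    · rintro _ ⟨z, hz, rfl⟩ _ ⟨w, hw, rfl⟩
      exact hsmall z hz.1 w hw.1 hz.2 hw.2
  have heq : ∀ ζ ∈ closedBall (0 : ℂ) 1,
      Tendsto φ (𝓝[ball 0 1] ζ) (𝓝 (extendFrom (ball 0 1) φ ζ)) := fun ζ hζ => by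
    obtain ⟨y, hy⟩ := hlim ζ hζ
    rwa [extendFrom_eq (hcl ▸ hζ) hy]
  refine ⟨extendFrom (ball 0 1) φ, continuousOn_extendFrom hcl.ge hlim, fun z hz => ?_,
    fun ζ hζ => ?_⟩
  · exact extendFrom_eq (subset_closure hz) (h.diff.continuousOn z hz)
  · have hζc : ζ ∈ closedBall (0 : ℂ) 1 := sphere_subset_closedBall hζ
    have hne : (𝓝[ball 0 1] ζ).NeBot := mem_closure_iff_nhdsWithin_neBot.mp (hcl ▸ hζc)
    have ht := heq ζ hζc
    set y := extendFrom (ball 0 1) φ ζ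
    apply hfr
    rw [hU.frontier_eq]
    refine ⟨mem_closure_of_tendsto ht ?_, fun hy => ?_⟩
    · filter_upwards [self_mem_nhdsWithin] with z hz using h.mapsTo hz
    -- A boundary limit `y` inside `U` would give g(y) = ζ by continuity of `g`, but g(y) lies in
    -- the open disk.
    · have h1 : Tendsto (fun z => g (φ z)) (𝓝[ball 0 1] ζ) (𝓝 (g y)) :=
        ((h.diff_inv.differentiableAt (hU.mem_nhds hy)).continuousAt.tendsto).comp ht
      have h2 : Tendsto (fun z => g (φ z)) (𝓝[ball 0 1] ζ) (𝓝 ζ) := by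
        refine (tendsto_id.mono_left nhdsWithin_le_nhds).congr' ?_
        filter_upwards [self_mem_nhdsWithin] with z hz using (h.left_inv z hz).symm
      have h3 := h.mapsTo_inv hy
      rw [tendsto_nhds_unique h1 h2, mem_ball_zero_iff] at h3
      rw [mem_sphere_zero_iff_norm] at hζ
      linarith

end Caratheodory

end KnotTorus

namespace KnotTorus

/-! ### Injectivity on the boundary and Jordan domains. -/

section JordanDomain

open Set Metric Topology Filter Complex

theorem circle_eq_neg_mul_exp (t₀ t : Circle) :
    t = -t₀ * Circle.exp (Complex.arg (((-t₀)⁻¹ * t : Circle) : ℂ)) := by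
  rw [Circle.exp_arg, mul_inv_cancel_left]

theorem arg_ne_pi_of_ne {t₀ t : Circle} (h : t ≠ t₀) :
    Complex.arg (((-t₀)⁻¹ * t : Circle) : ℂ) ≠ Real.pi := by
  intro hpi
  have h1 := circle_eq_neg_mul_exp t₀ t
  rw [hpi] at h1
  apply h
  rw [h1]
  ext
  simp

theorem isPreconnected_compl_singleton_circle (t₀ : Circle) :
    IsPreconnected ({t₀}ᶜ : Set Circle) := by
  have h : ({t₀}ᶜ : Set Circle) = (fun s : ℝ => -t₀ * Circle.exp s) '' Ioo (-Real.pi) Real.pi := by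
    ext t
    constructor
    · intro ht
      exact ⟨_, ⟨Complex.neg_pi_lt_arg _, lt_of_le_of_ne (Complex.arg_le_pi _)
        (arg_ne_pi_of_ne ht)⟩, (circle_eq_neg_mul_exp t₀ t).symm⟩
    · rintro ⟨s, hs, rfl⟩ h
      have h1 : Circle.exp s = -1 := by
        have h1 : -t₀ * Circle.exp s = t₀ := mem_singleton_iff.mp h
        have h2 : -t₀ * Circle.exp s = -t₀ * -1 := by rw [h1]; ext; simp
        exact mul_left_cancel h2
      have h2 : Circle.exp Real.pi = -1 := by ext; simp
      have h3 := Circle.arg_exp hs.1 hs.2.le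
      rw [h1, ← h2, Circle.arg_exp (by linarith [Real.pi_pos]) le_rfl] at h3
      exact hs.2.ne h3.symm
  rw [h]
  exact isPreconnected_Ioo.image _ (by fun_prop)

/-- A nonvanishing function on the circle has a continuous logarithm off any point. -/
theorem hasContLog_compl_singleton_circle {f : Circle → ℂ} (hf : Continuous f) (h0 : ∀ t, f t ≠ 0)
    (t₀ : Circle) : HasContLog ({t₀}ᶜ : Set Circle) f := by
  obtain ⟨F, ⟨-, hF⟩, -⟩ := Complex.isCoveringMapOn_exp.existsUnique_continuousMap_lifts
    (⟨fun s : ℝ => f (-t₀ * Circle.exp s), by fun_prop⟩ : C(ℝ, ℂ)) (a₀ := 0)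
    (e₀ := Complex.log (f (-t₀ * Circle.exp 0))) (Complex.exp_log (h0 _)) (fun a => h0 _)
  refine ⟨fun t => F (Complex.arg (((-t₀)⁻¹ * t : Circle) : ℂ)), ?_, fun t ht => ?_⟩
  · refine F.continuous.comp_continuousOn fun t ht => ContinuousAt.continuousWithinAt ?_
    refine ContinuousAt.comp (f := fun t : Circle => (((-t₀)⁻¹ * t : Circle) : ℂ))
      (Complex.continuousAt_arg ?_) (by fun_prop)
    exact Complex.mem_slitPlane_iff_arg.mpr ⟨arg_ne_pi_of_ne ht, Circle.coe_ne_zero _⟩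
  · have h1 := congrFun hF (Complex.arg (((-t₀)⁻¹ * t : Circle) : ℂ))
    simp only [Function.comp_apply, ContinuousMap.coe_mk] at h1
    rw [h1, ← circle_eq_neg_mul_exp]

/-- A function continuous on the closed disk and holomorphic inside that is constant on a boundary
arc takes the same value at the centre. -/
theorem eq_of_const_on_arc {Φ : ℂ → ℂ} (hc : ContinuousOn Φ (closedBall 0 1))
    (hd : DifferentiableOn ℂ Φ (ball 0 1)) {a b : ℝ} (hab : a < b) {p : ℂ}
    (h : ∀ θ ∈ Ioo a b, Φ (Complex.exp (θ * I)) = p) : Φ 0 = p := by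
  have hpi := Real.pi_pos
  obtain ⟨N, hN⟩ := exists_nat_gt (2 * Real.pi / (b - a))
  have hN0 : 0 < (N : ℝ) := lt_trans (div_pos (by positivity) (sub_pos.mpr hab)) hN
  have hNn : 0 < N := by exact_mod_cast hN0
  have hNlt : 2 * Real.pi / N < b - a := by
    rw [div_lt_iff₀ (sub_pos.mpr hab)] at hN
    rw [div_lt_iff₀ hN0]
    linarith
  set ω : ℕ → ℂ := fun k => Complex.exp ((2 * Real.pi * k / N : ℝ) * I) with hω
  have hωn : ∀ k, ‖ω k‖ = 1 := fun k => Complex.norm_exp_ofReal_mul_I _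
  -- The arc is longer than 2π/N, so its rotations by the `N`-th roots of unity cover the circle and
  -- the product vanishes on all of it. By the maximum principle G(0) = (Φ(0) - p)ᴺ vanishes as
  -- well.
  set G : ℂ → ℂ := fun z => ∏ k ∈ Finset.range N, (Φ (ω k * z) - p) with hG
  have hmaps : ∀ k, MapsTo (fun z => ω k * z) (ball 0 1) (ball 0 1) := fun k z hz => by
    rw [mem_ball_zero_iff] at hz ⊢
    rwa [norm_mul, hωn, one_mul]
  have hmaps' : ∀ k, MapsTo (fun z => ω k * z) (closedBall 0 1) (closedBall 0 1) := fun k z hz => by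
    rw [mem_closedBall_zero_iff] at hz ⊢
    rwa [norm_mul, hωn, one_mul]
  have hGd : DiffContOnCl ℂ G (ball 0 1) := by
    refine ⟨DifferentiableOn.fun_finsetProd fun k _ => ?_, ?_⟩
    · exact (hd.comp (by fun_prop) (hmaps k)).sub_const p
    · rw [closure_ball 0 one_ne_zero]
      exact continuousOn_finsetProd _ fun k _ =>
        (hc.comp (by fun_prop) (hmaps' k)).sub continuousOn_const
  have hGfr : ∀ z ∈ frontier (ball (0 : ℂ) 1), ‖G z‖ ≤ 0 := by
    intro z hz
    rw [frontier_ball 0 one_ne_zero, mem_sphere_zero_iff_norm] at hz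
    rw [norm_le_zero_iff, hG]
    set θ := Complex.arg z
    have hzθ : z = Complex.exp (θ * I) := by
      have := Complex.norm_mul_exp_arg_mul_I z
      rw [hz, Complex.ofReal_one, one_mul] at this
      exact this.symm
    -- The least `m` with θ + 2πm/N > a; the step 2π/N is shorter than b - a, so this angle is still
    -- below `b`.
    set m : ℤ := ⌊(a - θ) * N / (2 * Real.pi)⌋ + 1 with hm
    have hNz : (N : ℤ) ≠ 0 := by exact_mod_cast hNn.ne'
    have hkm : (((m % N).toNat : ℤ)) = m % N := Int.toNat_of_nonneg (Int.emod_nonneg _ hNz)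
    have hkN : (m % N).toNat < N := by
      have := Int.emod_lt_of_pos m (show (0 : ℤ) < N by exact_mod_cast hNn)
      omega
    refine Finset.prod_eq_zero (Finset.mem_range.mpr hkN) ?_
    rw [sub_eq_zero]
    have h1 : ω (m % N).toNat * z = Complex.exp ((θ + 2 * Real.pi * m / N : ℝ) * I) := by
      rw [hω, hzθ, ← Complex.exp_add, Complex.exp_eq_exp_iff_exists_int]
      refine ⟨-(m / N), ?_⟩
      have h2 : ((m % N).toNat : ℂ) = m - N * ((m / N : ℤ) : ℂ) := by
        have h3 : ((m % N).toNat : ℤ) = m - N * (m / N) := by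
          rw [hkm]; exact Int.emod_def m N
        exact_mod_cast congrArg (Int.cast : ℤ → ℂ) h3
      have hNc : (N : ℂ) ≠ 0 := by exact_mod_cast hNn.ne'
      push_cast
      rw [h2]
      field_simp
      ring
    rw [h1]
    refine h _ ⟨?_, ?_⟩
    · have h2 := Int.lt_floor_add_one ((a - θ) * N / (2 * Real.pi))
      have h3 : (a - θ) * N / (2 * Real.pi) < m := by rw [hm]; push_cast; exact h2
      rw [div_lt_iff₀ (by positivity)] at h3
      have h4 : a - θ < 2 * Real.pi * m / N := by rw [lt_div_iff₀ hN0]; linarith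
      linarith
    · have h2 := Int.floor_le ((a - θ) * N / (2 * Real.pi))
      have h3 : (m : ℝ) - 1 ≤ (a - θ) * N / (2 * Real.pi) := by rw [hm]; push_cast; linarith
      rw [le_div_iff₀ (by positivity)] at h3
      have h4 : 2 * Real.pi * m / N - 2 * Real.pi / N ≤ a - θ := by
        rw [← sub_div, div_le_iff₀ hN0]; linarith
      linarith
  have h0 := Complex.norm_le_of_forall_mem_frontier_norm_le isBounded_ball hGd hGfr
    (subset_closure (mem_ball_self one_pos) : (0 : ℂ) ∈ closure (ball 0 1))
  rw [norm_le_zero_iff, hG] at h0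
  simp only [mul_zero, Finset.prod_const, Finset.card_range] at h0
  exact sub_eq_zero.mp (pow_eq_zero_iff hNn.ne' |>.mp h0)

/-- The open sector of the unit disk between two angles. -/
noncomputable def sector (a b : ℝ) : Set ℂ :=
  Complex.exp '' {w | w.re < 0 ∧ a < w.im ∧ w.im < b}

/-- The closed radius of the unit disk at a given angle. -/
noncomputable def radius (θ : ℝ) : Set ℂ :=
  (fun ρ : ℝ => ρ * Complex.exp (θ * I)) '' Icc 0 1

theorem isOpen_sector (a b : ℝ) : IsOpen (sector a b) :=
  Complex.isOpenMap_exp _ ((isOpen_lt Complex.continuous_re continuous_const).inter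
    ((isOpen_lt continuous_const Complex.continuous_im).inter
      (isOpen_lt Complex.continuous_im continuous_const)))

theorem isPreconnected_sector (a b : ℝ) : IsPreconnected (sector a b) := by
  refine IsPreconnected.image (Convex.isPreconnected ?_) _ Complex.continuous_exp.continuousOn
  exact (convex_halfSpace_re_lt 0).inter ((convex_halfSpace_im_gt a).inter
    (convex_halfSpace_im_lt b))

theorem sector_subset_ball (a b : ℝ) : sector a b ⊆ ball 0 1 := by
  rintro _ ⟨w, hw, rfl⟩
  rw [mem_ball_zero_iff, Complex.norm_exp, Real.exp_lt_one_iff]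
  exact hw.1

theorem sector_nonempty {a b : ℝ} (h : a < b) : (sector a b).Nonempty :=
  ⟨_, ⟨-1, (a + b) / 2⟩, ⟨by simp, by simp; linarith, by simp; linarith⟩, rfl⟩

theorem radius_add_two_pi (θ : ℝ) : radius (θ + 2 * Real.pi) = radius θ := by
  have : Complex.exp ((θ + 2 * Real.pi : ℝ) * I) = Complex.exp (θ * I) := by
    push_cast
    rw [add_mul, Complex.exp_periodic]
  rw [radius, radius, this]

theorem isCompact_radius (θ : ℝ) : IsCompact (radius θ) := isCompact_Icc.image (by fun_prop)

theorem radius_subset (θ : ℝ) : radius θ ⊆ insert (Complex.exp (θ * I)) (ball 0 1) := by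
  rintro _ ⟨ρ, hρ, rfl⟩
  rcases hρ.2.lt_or_eq with h | rfl
  · right
    simp [abs_of_nonneg hρ.1, h]
  · left
    simp

theorem exp_mem_radius (θ : ℝ) : Complex.exp (θ * I) ∈ radius θ := ⟨1, by simp, by simp⟩

theorem eq_of_ofReal_mul_exp_eq {ρ ρ' α β : ℝ} (hρ : 0 < ρ) (hρ' : 0 < ρ')
    (h : (ρ : ℂ) * Complex.exp (α * I) = ρ' * Complex.exp (β * I)) :
    ∃ n : ℤ, α = β + n * (2 * Real.pi) := by
  have h1 : ρ = ρ' := by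
    have := congrArg norm h
    simpa [abs_of_pos hρ, abs_of_pos hρ'] using this
  subst h1
  have h2 := mul_left_cancel₀ (Complex.ofReal_ne_zero.mpr hρ.ne') h
  refine Circle.exp_eq_exp.mp (Circle.ext ?_)
  simpa using h2

theorem mem_sector_iff {a b : ℝ} {z : ℂ} :
    z ∈ sector a b ↔ ∃ ρ ∈ Ioo (0 : ℝ) 1, ∃ θ ∈ Ioo a b, (ρ : ℂ) * Complex.exp (θ * I) = z := by
  constructor
  · rintro ⟨w, hw, rfl⟩
    refine ⟨Real.exp w.re, ⟨Real.exp_pos _, Real.exp_lt_one_iff.mpr hw.1⟩, w.im, hw.2, ?_⟩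
    rw [Complex.ofReal_exp, ← Complex.exp_add, Complex.re_add_im]
  · rintro ⟨ρ, hρ, θ, hθ, rfl⟩
    refine ⟨Real.log ρ + θ * I, ⟨?_, ?_, ?_⟩, ?_⟩
    · simpa using Real.log_neg hρ.1 hρ.2
    · simpa using hθ.1
    · simpa using hθ.2
    · rw [Complex.exp_add, ← Complex.ofReal_exp, Real.exp_log hρ.1]

theorem disjoint_sector {a b c : ℝ} (hc : c ≤ a + 2 * Real.pi) :
    Disjoint (sector a b) (sector b c) := by
  rw [disjoint_left]
  intro z h1 h2
  obtain ⟨ρ, hρ, θ, hθ, rfl⟩ := mem_sector_iff.mp h1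
  obtain ⟨ρ', hρ', θ', hθ', h⟩ := mem_sector_iff.mp h2
  obtain ⟨n, hn⟩ := eq_of_ofReal_mul_exp_eq hρ'.1 hρ.1 h
  have hpi := Real.pi_pos
  have h3 : 0 < (n : ℝ) := by
    by_contra! hcon
    nlinarith [hθ.2, hθ'.1]
  have h4 : (n : ℝ) < 1 := by
    by_contra! hcon
    nlinarith [hθ.1, hθ'.2]
  have h5 : (0 : ℤ) < n := by exact_mod_cast h3
  have h6 : n < (1 : ℤ) := by exact_mod_cast h4
  omega

theorem disjoint_radius_sector {a b : ℝ} {θ : ℝ} (h1 : θ ≤ a) (h2 : b ≤ θ + 2 * Real.pi) :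
    Disjoint (radius θ) (sector a b) := by
  rw [disjoint_left]
  rintro _ ⟨ρ, hρ, rfl⟩ h
  obtain ⟨ρ', hρ', θ', hθ', h⟩ := mem_sector_iff.mp h
  have hρ0 : 0 < ρ := lt_of_le_of_ne hρ.1 fun h0 => by
    rw [← h0] at h
    simp [hρ'.1.ne'] at h
  obtain ⟨n, hn⟩ := eq_of_ofReal_mul_exp_eq hρ'.1 hρ0 h
  have hpi := Real.pi_pos
  have h3 : 0 < (n : ℝ) := by
    by_contra! hcon
    nlinarith [hθ'.1]
  have h4 : (n : ℝ) < 1 := by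
    by_contra! hcon
    nlinarith [hθ'.2]
  have h5 : (0 : ℤ) < n := by exact_mod_cast h3
  have h6 : n < (1 : ℤ) := by exact_mod_cast h4
  omega

theorem closure_sector_subset {a b : ℝ} {z : ℂ} (hz : z ∈ closure (sector a b)) (h1 : ‖z‖ < 1) :
    z ∈ sector a b ∪ (radius a ∪ radius b) := by
  have hK : IsCompact ((fun q : ℝ × ℝ => (q.1 : ℂ) * Complex.exp (q.2 * I)) ''
      (Icc 0 1 ×ˢ Icc a b)) := (isCompact_Icc.prod isCompact_Icc).image (by fun_prop)
  have hsub : sector a b ⊆ (fun q : ℝ × ℝ => (q.1 : ℂ) * Complex.exp (q.2 * I)) ''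
      (Icc 0 1 ×ˢ Icc a b) := by
    intro w hw
    obtain ⟨ρ, hρ, θ, hθ, rfl⟩ := mem_sector_iff.mp hw
    exact ⟨(ρ, θ), ⟨Ioo_subset_Icc_self hρ, Ioo_subset_Icc_self hθ⟩, rfl⟩
  obtain ⟨⟨ρ, θ⟩, ⟨hρ, hθ⟩, rfl⟩ := closure_minimal hsub hK.isClosed hz
  simp only at hρ hθ h1 ⊢
  rcases hρ.1.eq_or_lt with h0 | h0
  · right; left
    exact ⟨0, by simp, by simp [← h0]⟩
  rcases hθ.1.eq_or_lt with rfl | ha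
  · exact Or.inr (Or.inl ⟨ρ, hρ, rfl⟩)
  rcases hθ.2.eq_or_lt with rfl | hb
  · exact Or.inr (Or.inr ⟨ρ, hρ, rfl⟩)
  · left
    refine mem_sector_iff.mpr ⟨ρ, ⟨h0, ?_⟩, θ, ⟨ha, hb⟩, rfl⟩
    simpa [abs_of_pos h0] using h1

theorem exp_mem_closure_sector {a b θ : ℝ} (hθ : θ ∈ Ioo a b) :
    Complex.exp (θ * I) ∈ closure (sector a b) := by
  have ht : Tendsto (fun s : ℝ => Complex.exp (s + θ * I)) (𝓝[<] 0) (𝓝 (Complex.exp (θ * I))) := by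
    have : Continuous fun s : ℝ => Complex.exp (s + θ * I) := by fun_prop
    have h := this.tendsto 0
    rw [Complex.ofReal_zero, zero_add] at h
    exact h.mono_left nhdsWithin_le_nhds
  refine mem_closure_of_tendsto ht ?_
  filter_upwards [self_mem_nhdsWithin] with s hs
  exact ⟨s + θ * I, ⟨by simpa using hs, by simpa using hθ.1, by simpa using hθ.2⟩, rfl⟩

variable {U : Set ℂ} {Φ g : ℂ → ℂ} {J : Circle → ℂ}

/-- Inside `U` the inverse `g` pulls a limit point back to the closed sector; a limit point outside
`U` lies on its frontier. -/
theorem IsRiemannPair.closure_image_sector (h : IsRiemannPair U Φ g) (hU : IsOpen U)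
    (hfr : frontier U ⊆ range J) {a b : ℝ} {z : ℂ} (hz : z ∈ closure (Φ '' sector a b)) :
    z ∈ Φ '' sector a b ∨ z ∈ Φ '' (radius a ∪ radius b) ∪ range J := by
  by_cases hzU : z ∈ U
  · have h1 := h.mem_closure_of_mem_closure_image hU (sector_subset_ball a b) hzU hz
    rcases closure_sector_subset h1 (mem_ball_zero_iff.mp (h.mapsTo_inv hzU)) with h2 | h2
    · exact Or.inl ⟨_, h2, h.right_inv z hzU⟩
    · exact Or.inr (Or.inl ⟨_, h2, h.right_inv z hzU⟩)
  · right; right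
    apply hfr
    rw [hU.frontier_eq]
    refine ⟨closure_mono ?_ hz, hzU⟩
    rintro _ ⟨w, hw, rfl⟩
    exact h.mapsTo (sector_subset_ball a b hw)

/-- If a Riemann map identifies two boundary points then it is constant on one of the arcs they
bound. -/
theorem IsRiemannPair.const_on_arc (h : IsRiemannPair U Φ g) (hU : IsOpen U)
    (hUc : IsPreconnected U) (hUb : Bornology.IsBounded U) (hJ : Continuous J)
    (hinj : Function.Injective J) (hfr : frontier U ⊆ range J) (hdisj : Disjoint U (range J))
    (hc : ContinuousOn Φ (closedBall 0 1)) (hb : MapsTo Φ (sphere 0 1) (range J))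
    {α β : ℝ} (hαβ : α < β) (hβα : β < α + 2 * Real.pi)
    (heq : Φ (Complex.exp (α * I)) = Φ (Complex.exp (β * I))) :
    (∀ θ ∈ Ioo α β, Φ (Complex.exp (θ * I)) = Φ (Complex.exp (α * I))) ∨
      ∀ θ ∈ Ioo β (α + 2 * Real.pi), Φ (Complex.exp (θ * I)) = Φ (Complex.exp (α * I)) := by
  -- The images of the two radii form a compact connected `C` that meets `J` only in `p`. For `w`
  -- and `w₀` in the images of the two sectors, (z - w)/(z - w₀) has a logarithm on `J` because both
  -- points lie in `U`. It has one on `C` because both arcs reach J ∖ {p}, which joins the two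
  -- images off `C`. Gluing at `p` contradicts Borsuk's criterion for `V₁`.
  by_contra! hcon
  obtain ⟨⟨θ₁, hθ₁, hne₁⟩, θ₂, hθ₂, hne₂⟩ := hcon
  set p := Φ (Complex.exp (α * I)) with hp
  set C := Φ '' (radius α ∪ radius β) with hC
  set V₁ := Φ '' sector α β with hV₁
  set V₂ := Φ '' sector β (α + 2 * Real.pi) with hV₂
  have hexp : ∀ θ : ℝ, Complex.exp (θ * I) ∈ sphere (0 : ℂ) 1 := fun θ => by
    rw [mem_sphere_zero_iff_norm, Complex.norm_exp_ofReal_mul_I]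
  have hrad : ∀ θ, radius θ ⊆ closedBall 0 1 := fun θ z hz => by
    rcases radius_subset θ hz with rfl | hz
    · exact sphere_subset_closedBall (hexp θ)
    · exact ball_subset_closedBall hz
  have hCcpt : IsCompact C := ((isCompact_radius α).union (isCompact_radius β)).image_of_continuousOn
    (hc.mono (union_subset (hrad α) (hrad β)))
  have hCsub : C ⊆ insert p U := by
    rintro _ ⟨z, hz | hz, rfl⟩
    · rcases radius_subset α hz with rfl | hz
      · exact Or.inl rfl
      · exact Or.inr (h.mapsTo hz)
    · rcases radius_subset β hz with rfl | hz
      · exact Or.inl heq.symm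
      · exact Or.inr (h.mapsTo hz)
  have hpC : p ∈ C := ⟨_, Or.inl (exp_mem_radius α), rfl⟩
  have hpJ : p ∈ range J := hb (hexp α)
  have hCJ : ∀ z ∈ C, z ∈ range J → z = p := fun z hz hzJ =>
    (hCsub hz).resolve_right fun hzU => disjoint_left.mp hdisj hzU hzJ
  have hVU : ∀ a b, Φ '' sector a b ⊆ U := by
    rintro a b _ ⟨w, hw, rfl⟩
    exact h.mapsTo (sector_subset_ball a b hw)
  have hVC : ∀ a b, Disjoint (radius α ∪ radius β) (sector a b) → Disjoint (Φ '' sector a b) C := by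
    intro a b hd
    rw [disjoint_left]
    rintro _ ⟨w, hw, rfl⟩ ⟨v, hv, hvw⟩
    have hwb := sector_subset_ball a b hw
    have hvb : v ∈ ball (0 : ℂ) 1 := by
      have h1 : v ∈ closedBall (0 : ℂ) 1 := union_subset (hrad α) (hrad β) hv
      by_contra hvb
      have h2 : v ∈ sphere (0 : ℂ) 1 := by
        rw [mem_sphere_zero_iff_norm]
        rw [mem_closedBall_zero_iff] at h1
        rw [mem_ball_zero_iff, not_lt] at hvb
        exact le_antisymm h1 hvb
      exact disjoint_left.mp hdisj (h.mapsTo hwb) (hvw ▸ hb h2)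
    rw [h.injOn hvb hwb hvw] at hv
    exact disjoint_left.mp hd hv hw
  have hpi := Real.pi_pos
  have hd₁ : Disjoint V₁ C := hVC _ _ (disjoint_union_left.mpr
    ⟨disjoint_radius_sector le_rfl (by linarith), by
      have h1 : radius β = radius (β - 2 * Real.pi) := by
        rw [← radius_add_two_pi (β - 2 * Real.pi), sub_add_cancel]
      rw [h1]
      exact disjoint_radius_sector (by linarith) (by linarith)⟩)
  have hd₂ : Disjoint V₂ C := hVC _ _ (disjoint_union_left.mpr
    ⟨disjoint_radius_sector hαβ.le le_rfl, disjoint_radius_sector le_rfl (by linarith)⟩)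
  have hd₁₂ : Disjoint V₁ V₂ := by
    rw [disjoint_left]
    rintro _ ⟨w, hw, rfl⟩ ⟨v, hv, hvw⟩
    have := h.injOn (sector_subset_ball _ _ hv) (sector_subset_ball _ _ hw) hvw
    exact disjoint_left.mp (disjoint_sector le_rfl) hw (this ▸ hv)
  obtain ⟨w, hw⟩ : V₁.Nonempty := (sector_nonempty hαβ).image Φ
  obtain ⟨w₀, hw₀⟩ : V₂.Nonempty := (sector_nonempty hβα).image Φ
  have hJcl : IsClosed (range J) := (isCompact_range hJ).isClosed
  have hlogJ : HasContLog (range J) (fun z => (z - w) / (z - w₀)) :=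
    hasContLog_sub_div_sub hJcl hUc hdisj (hVU _ _ hw) (hVU _ _ hw₀)
  -- the two sectors are joined by the punctured curve in the complement of `C`
  have hJp : IsPreconnected (range J \ {p}) := by
    obtain ⟨t₀, ht₀⟩ := hpJ
    have : range J \ {p} = J '' {t₀}ᶜ := by
      rw [image_compl_eq_range_sdiff_image hinj, image_singleton, ht₀]
    rw [this]
    exact (isPreconnected_compl_singleton_circle t₀).image _ hJ.continuousOn
  have hjoin : ∀ a b θ : ℝ, θ ∈ Ioo a b → Φ (Complex.exp (θ * I)) ≠ p →
      Disjoint (Φ '' sector a b) C → IsPreconnected (Φ '' sector a b ∪ range J \ {p}) ∧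
        Disjoint (Φ '' sector a b ∪ range J \ {p}) C := by
    intro a b θ hθ hne hd
    set q := Φ (Complex.exp (θ * I)) with hq
    have hqJ : q ∈ range J \ {p} := ⟨hb (hexp θ), hne⟩
    have hqcl : q ∈ closure (Φ '' sector a b) := by
      have h1 : ContinuousWithinAt Φ (sector a b) (Complex.exp (θ * I)) :=
        (hc _ (sphere_subset_closedBall (hexp θ))).mono
          ((sector_subset_ball a b).trans ball_subset_closedBall)
      exact h1.mem_closure_image (exp_mem_closure_sector hθ)
    have h2 : IsPreconnected (insert q (Φ '' sector a b)) :=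
      ((isPreconnected_sector a b).image Φ (hc.mono
        ((sector_subset_ball a b).trans ball_subset_closedBall))).subset_closure
        (subset_insert _ _) (insert_subset hqcl subset_closure)
    refine ⟨?_, ?_⟩
    · have h3 := h2.union q (mem_insert _ _) hqJ hJp
      rwa [insert_union, insert_eq_of_mem
        (show q ∈ Φ '' sector a b ∪ range J \ {p} from Or.inr hqJ)] at h3
    · exact disjoint_union_left.mpr ⟨hd, disjoint_left.mpr fun z hz hzC => hz.2 (hCJ z hzC hz.1)⟩
  obtain ⟨hc₁, hdc₁⟩ := hjoin _ _ _ hθ₁ hne₁ hd₁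
  obtain ⟨hc₂, hdc₂⟩ := hjoin _ _ _ hθ₂ hne₂ hd₂
  have hlogC : HasContLog C (fun z => (z - w) / (z - w₀)) := by
    refine hasContLog_sub_div_sub hCcpt.isClosed
      (hc₁.union (Φ (Complex.exp (θ₁ * I))) (Or.inr ⟨hb (hexp θ₁), hne₁⟩)
        (Or.inr ⟨hb (hexp θ₁), hne₁⟩) hc₂) (disjoint_union_left.mpr ⟨hdc₁, hdc₂⟩)
      (Or.inl (Or.inl hw)) (Or.inr (Or.inl hw₀))
  have hinter : C ∩ range J = {p} := by
    ext z
    constructor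
    · exact fun hz => hCJ z hz.1 hz.2
    · rintro rfl
      exact ⟨hpC, hpJ⟩
  have hglue := HasContLog.union hCcpt.isClosed hJcl (hinter ▸ isPreconnected_singleton) hlogC hlogJ
  have hcl : ∀ z ∈ closure V₁, z ≠ w₀ := by
    rintro z hz rfl
    rcases h.closure_image_sector hU hfr hz with h1 | h1 | h1
    · exact disjoint_left.mp hd₁₂ h1 hw₀
    · exact disjoint_left.mp hd₂ hw₀ h1
    · exact disjoint_left.mp hdisj (hVU _ _ hw₀) h1
  refine not_hasContLog_frontier (hUb.subset (hVU α β)) hw (u := fun z => z - w₀) (by fun_prop)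
    (fun z hz => sub_ne_zero.mpr (hcl z hz)) (hglue.mono ?_)
  intro z hz
  have hV₁o : IsOpen V₁ := h.isOpen_image (isOpen_sector α β) (sector_subset_ball α β)
  rw [hV₁o.frontier_eq] at hz
  exact (h.closure_image_sector hU hfr hz.1).resolve_left hz.2

/-- Two identified boundary points would make Φ constant on an arc, so that Φ(0) would equal a
boundary value, on `J` instead of in `U`. -/
theorem IsRiemannPair.injOn_closedBall (h : IsRiemannPair U Φ g) (hU : IsOpen U)
    (hUc : IsPreconnected U) (hUb : Bornology.IsBounded U) (hJ : Continuous J)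
    (hinj : Function.Injective J) (hfr : frontier U ⊆ range J) (hdisj : Disjoint U (range J))
    (hc : ContinuousOn Φ (closedBall 0 1)) (hb : MapsTo Φ (sphere 0 1) (range J)) :
    InjOn Φ (closedBall 0 1) := by
  have hΦ0 : Φ 0 ∉ range J := disjoint_left.mp hdisj (h.mapsTo (mem_ball_self one_pos))
  have key : ∀ α β : ℝ, α < β → β < α + 2 * Real.pi →
      Φ (Complex.exp (α * I)) ≠ Φ (Complex.exp (β * I)) := by
    intro α β h1 h2 heq
    have hmem : Φ (Complex.exp (α * I)) ∈ range J :=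
      hb (by rw [mem_sphere_zero_iff_norm, Complex.norm_exp_ofReal_mul_I])
    rcases h.const_on_arc hU hUc hUb hJ hinj hfr hdisj hc hb h1 h2 heq with h3 | h3
    · exact hΦ0 (eq_of_const_on_arc hc h.diff h1 h3 ▸ hmem)
    · exact hΦ0 (eq_of_const_on_arc hc h.diff h2 h3 ▸ hmem)
  have hsphere : InjOn Φ (sphere 0 1) := by
    have harg : ∀ z ∈ sphere (0 : ℂ) 1, z = Complex.exp (Complex.arg z * I) := fun z hz => by
      have := Complex.norm_mul_exp_arg_mul_I z
      rw [mem_sphere_zero_iff_norm.mp hz, Complex.ofReal_one, one_mul] at this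
      exact this.symm
    intro z hz w hw hzw
    rw [harg z hz, harg w hw] at hzw
    have h1 := Complex.neg_pi_lt_arg z
    have h2 := Complex.neg_pi_lt_arg w
    have h3 := Complex.arg_le_pi z
    have h4 := Complex.arg_le_pi w
    rcases lt_trichotomy (Complex.arg z) (Complex.arg w) with h5 | h5 | h5
    · exact absurd hzw (key _ _ h5 (by linarith))
    · rw [harg z hz, harg w hw, h5]
    · exact absurd hzw.symm (key _ _ h5 (by linarith))
  rw [← ball_union_sphere]
  rintro z (hz | hz) w (hw | hw) hzw
  · exact h.injOn hz hw hzw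
  · exact absurd (hzw ▸ hb hw) (disjoint_left.mp hdisj (h.mapsTo hz))
  · exact absurd (hzw ▸ hb hz) (disjoint_left.mp hdisj (h.mapsTo hw))
  · exact hsphere hz hw hzw

/-- The component of the origin in the complement of a Jordan curve that winds around the origin is
the interior of an embedded closed disk bounded by the curve. -/
theorem exists_jordan_domain (hJ : Continuous J) (hinj : Function.Injective J) (h0 : ∀ t, J t ≠ 0)
    (hlog : ¬ HasContLog univ J) : ∃ U Φ g, IsOpen U ∧ _root_.IsConnected U ∧
      Bornology.IsBounded U ∧ frontier U ⊆ range J ∧ Disjoint U (range J) ∧ IsRiemannPair U Φ g ∧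
      ContinuousOn Φ (closedBall 0 1) ∧ InjOn Φ (closedBall 0 1) ∧ Φ '' sphere 0 1 = range J := by
  have hcpt : IsCompact (range J) := isCompact_range hJ
  have h0mem : (0 : ℂ) ∈ (range J)ᶜ := by
    rintro ⟨t, ht⟩
    exact h0 t ht
  set U := connectedComponentIn (range J)ᶜ 0 with hUdef
  have hU : IsOpen U := hcpt.isClosed.isOpen_compl.connectedComponentIn
  have hUc : _root_.IsConnected U := isConnected_connectedComponentIn_iff.mpr h0mem
  have hlogr : ¬ HasContLog (range J) (fun z => z - 0) := fun hl => hlog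
    ((hl.comp hJ.continuousOn fun t _ => mem_range_self t).congr fun t _ => sub_zero _)
  have hUb : Bornology.IsBounded U := by
    by_contra hb
    exact hlogr (hasContLog_sub_of_not_isBounded hcpt hb)
  have hfr : frontier U ⊆ range J := frontier_connectedComponentIn_subset hcpt.isClosed 0
  have hdisj : Disjoint U (range J) :=
    disjoint_left.mpr fun z hz => connectedComponentIn_subset _ _ hz
  have hUk := isPreconnected_compl_connectedComponentIn hcpt.isClosed
    (isConnected_range hJ) 0
  have h0U : (0 : ℂ) ∈ U := mem_connectedComponentIn h0mem
  obtain ⟨φ, g, hφ⟩ := exists_isRiemannPair hU hUc hUb hUk h0U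
  obtain ⟨Φ, hc, heq, hb⟩ := hφ.exists_continuousOn_extension hU hUc.isPreconnected hUb hJ hinj
    hfr hdisj
  have hΦ : IsRiemannPair U Φ g :=
    ⟨hφ.diff.congr heq, hφ.diff_inv, fun z hz => by rw [heq hz]; exact hφ.mapsTo hz,
      hφ.mapsTo_inv, fun z hz => by rw [heq hz]; exact hφ.left_inv z hz,
      fun w hw => by rw [heq (hφ.mapsTo_inv hw)]; exact hφ.right_inv w hw,
      by rw [heq (mem_ball_self one_pos)]; exact hφ.map_zero⟩
  refine ⟨U, Φ, g, hU, hUc, hUb, hfr, hdisj, hΦ, hc,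
    hΦ.injOn_closedBall hU hUc.isPreconnected hUb hJ hinj hfr hdisj hc hb,
    subset_antisymm hb.image_subset ?_⟩
  have hfr' : frontier U ⊆ Φ '' sphere 0 1 := by
    intro z hz
    have h1 : closure U ⊆ Φ '' closedBall 0 1 := by
      refine closure_minimal (show U ⊆ Φ '' closedBall 0 1 from fun w hw =>
        ⟨g w, ball_subset_closedBall (hΦ.mapsTo_inv hw),
        hΦ.right_inv w hw⟩) ((isCompact_closedBall 0 1).image_of_continuousOn hc).isClosed
    obtain ⟨w, hw, rfl⟩ := h1 (frontier_subset_closure hz)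
    rw [← ball_union_sphere] at hw
    refine ⟨w, hw.resolve_left fun hwb => ?_, rfl⟩
    rw [hU.frontier_eq] at hz
    exact hz.2 (hΦ.mapsTo hwb)
  refine Subset.trans ?_ hfr'
  rintro _ ⟨t₀, rfl⟩
  -- If a point of `J` were missing from the frontier, the frontier would lie in an open arc, where
  -- every nonvanishing function of the parameter has a logarithm. Borsuk's criterion at 0 forbids
  -- this.
  by_contra ht₀
  have hemb : IsClosedEmbedding J := hJ.isClosedEmbedding hinj
  have hinv : ∀ t, Function.invFun J (J t) = t := Function.leftInverse_invFun hinj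
  have hinvc : ContinuousOn (Function.invFun J) (range J) := by
    rw [hemb.isEmbedding.continuousOn_iff]
    refine continuousOn_id.congr ?_
    rintro _ ⟨t, rfl⟩
    simp [hinv t]
  have hl := (hasContLog_compl_singleton_circle hJ h0 t₀).comp (hinvc.mono hfr)
    (fun z hz ht => by
      obtain ⟨t, rfl⟩ := hfr hz
      rw [mem_singleton_iff, hinv] at ht
      exact ht₀ (ht ▸ hz))
  refine not_hasContLog_frontier hUb h0U (u := fun _ => 1) continuousOn_const (by simp)
    (hl.congr fun z hz => ?_)
  obtain ⟨t, rfl⟩ := hfr hz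
  simp [hinv t]

end JordanDomain

end KnotTorus

namespace KnotTorus

/-! ### The winding cocycle and lifts of homologically trivial curves. -/

section Winding

/-- A lift of a circle-valued map to the line is determined by its value at a point. -/
theorem sub_eq_sub_of_exp_eq {A : Type*} [TopologicalSpace A] [PreconnectedSpace A]
    (F G : C(A, ℝ)) (h : ∀ a, Circle.exp (F a) = Circle.exp (G a)) (a b : A) :
    F a - F b = G a - G b := by
  have h1 : (fun x => F x + (G b - F b)) = G := by
    refine Circle.isCoveringMap_exp.eq_of_comp_eq (by fun_prop) G.continuous ?_ b (by simp)
    funext x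
    have hb : Circle.exp (G b - F b) = 1 := by rw [Circle.exp_sub, h b, div_self']
    simp [Circle.exp_add, hb, h x]
  have h2 : F a + (G b - F b) = G a := congrFun h1 a
  linarith

theorem exists_lift_stdSimplex {n : ℕ} (f : C(stdSimplex ℝ (Fin (n + 1)), Circle)) :
    ∃ F : C(stdSimplex ℝ (Fin (n + 1)), ℝ), ∀ s, Circle.exp (F s) = f s := by
  have h1 : Convex ℝ (stdSimplex ℝ (Fin (n + 1))) := convex_stdSimplex ℝ _
  have := h1.locallyPathConnectedSpace
  have := h1.contractibleSpace (Set.nonempty_coe_sort.mp inferInstance)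
  obtain ⟨e, he⟩ := Circle.exp_surjective (f (stdSimplex.vertex 0))
  obtain ⟨F, ⟨-, hF⟩, -⟩ := Circle.isCoveringMap_exp.existsUnique_continuousMap_lifts f
    (stdSimplex.vertex 0) e he
  exact ⟨F, congrFun hF⟩

/-- The increment of the argument of a circle-valued map along the standard 1-simplex. -/
noncomputable def argIncrement (f : C(stdSimplex ℝ (Fin 2), Circle)) : ℝ :=
  (exists_lift_stdSimplex f).choose (stdSimplex.vertex 1) -
    (exists_lift_stdSimplex f).choose (stdSimplex.vertex 0)

theorem argIncrement_eq {f : C(stdSimplex ℝ (Fin 2), Circle)} (F : C(stdSimplex ℝ (Fin 2), ℝ))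
    (hF : ∀ s, Circle.exp (F s) = f s) :
    argIncrement f = F (stdSimplex.vertex 1) - F (stdSimplex.vertex 0) :=
  sub_eq_sub_of_exp_eq _ _
    (fun s => ((exists_lift_stdSimplex f).choose_spec s).trans (hF s).symm) _ _

variable {X : Type} [TopologicalSpace X]

/-- The singular 1-cochain that assigns to a singular 1-simplex the increment of the argument of a
circle-valued map along it. -/
noncomputable def windingCochain (p : C(X, Circle)) :
    ((TopCat.toSSet.obj (TopCat.of X)).chainComplex (ModuleCat.of ℤ ℤ)).X 1 ⟶ ModuleCat.of ℤ ℝ :=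
  (SSet.isColimitChainComplexXCofan (TopCat.toSSet.obj (TopCat.of X)) (ModuleCat.of ℤ ℤ) 1).desc
    (Limits.Cofan.mk _ fun σ => ModuleCat.ofHom (LinearMap.toSpanSingleton ℤ ℝ
      (argIncrement (p.comp (TopCat.toSSetObjEquiv (TopCat.of X) (Opposite.op ⦋1⦌) σ)))))

theorem ι_windingCochain (p : C(X, Circle)) (σ : (TopCat.toSSet.obj (TopCat.of X)) _⦋1⦌) :
    SSet.ιChainComplex _ σ ≫ windingCochain p = ModuleCat.ofHom (LinearMap.toSpanSingleton ℤ ℝ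
      (argIncrement (p.comp (TopCat.toSSetObjEquiv (TopCat.of X) (Opposite.op ⦋1⦌) σ)))) :=
  (SSet.isColimitChainComplexXCofan (TopCat.toSSet.obj (TopCat.of X)) (ModuleCat.of ℤ ℤ) 1).fac _
    ⟨σ⟩

/-- A single lift over the 2-simplex computes the increments along all three faces, and their
alternating sum telescopes. -/
theorem d_windingCochain (p : C(X, Circle)) :
    ((TopCat.toSSet.obj (TopCat.of X)).chainComplex (ModuleCat.of ℤ ℤ)).d 2 1 ≫
      windingCochain p = 0 := by
  refine SSet.chainComplex_hom_ext fun σ => ?_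
  obtain ⟨F, hF⟩ := exists_lift_stdSimplex
    (p.comp (TopCat.toSSetObjEquiv (TopCat.of X) (Opposite.op ⦋2⦌) σ))
  have key (i : Fin 3) : argIncrement (p.comp (TopCat.toSSetObjEquiv (TopCat.of X)
      (Opposite.op ⦋1⦌) ((TopCat.toSSet.obj (TopCat.of X)).δ i σ))) =
      F (stdSimplex.vertex (SimplexCategory.δ i 1)) -
        F (stdSimplex.vertex (SimplexCategory.δ i 0)) := by
    rw [argIncrement_eq (F.comp ⟨_, stdSimplex.continuous_map (SimplexCategory.δ i)⟩)
      fun s => hF _]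
    simp [stdSimplex.map_vertex]
  have h := SSet.ιChainComplex_d_assoc (TopCat.toSSet.obj (TopCat.of X)) (R := ModuleCat.of ℤ ℤ) σ
    (windingCochain p)
  refine h.trans ?_
  rw [Fin.sum_univ_three]
  simp only [Preadditive.add_comp, Preadditive.zsmul_comp, ι_windingCochain, key]
  rw [show SimplexCategory.δ (0 : Fin 3) (1 : Fin 2) = (2 : Fin 3) from rfl,
    show SimplexCategory.δ (0 : Fin 3) (0 : Fin 2) = (1 : Fin 3) from rfl,
    show SimplexCategory.δ (1 : Fin 3) (1 : Fin 2) = (2 : Fin 3) from rfl,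
    show SimplexCategory.δ (1 : Fin 3) (0 : Fin 2) = (0 : Fin 3) from rfl,
    show SimplexCategory.δ (2 : Fin 3) (1 : Fin 2) = (1 : Fin 3) from rfl,
    show SimplexCategory.δ (2 : Fin 3) (0 : Fin 2) = (0 : Fin 3) from rfl, Limits.comp_zero]
  ext
  simp

/-- Being a cocycle, the winding cochain induces a map on homology, whose value on the class of `γ`
is the increment along its simplex. -/
theorem argIncrement_curveSimplex_eq_zero {γ : C(Circle, X)} (h : curveClass γ = 0)
    (p : C(X, Circle)) : argIncrement (p.comp (TopCat.toSSetObjEquiv (TopCat.of X)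
      (Opposite.op ⦋1⦌) (curveSimplex γ))) = 0 := by
  let K := singularChains X
  let Ψ : K.homology 1 ⟶ ModuleCat.of ℤ ℝ :=
    K.homologyι 1 ≫ K.descOpcycles (windingCochain p) 2 (by simp) (d_windingCochain p)
  have h1 : (K.liftCycles (curveChain γ) 0 (by simp) (curveChain_d γ) ≫ K.homologyπ 1) ≫ Ψ =
      curveChain γ ≫ windingCochain p := by
    simp only [Ψ, Category.assoc, HomologicalComplex.homology_π_ι_assoc,
      HomologicalComplex.liftCycles_i_assoc]
    exact congrArg (curveChain γ ≫ ·) (K.p_descOpcycles _ _ _ _)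
  have h2 : Ψ.hom (curveClass γ) = (curveChain γ ≫ windingCochain p).hom (1 : ℤ) := by
    rw [← h1]; rfl
  have h3 : Ψ.hom (curveClass γ) = 0 := by rw [h]; exact map_zero Ψ.hom
  have h4 := ι_windingCochain p (curveSimplex γ)
  rw [h3] at h2
  have h5 := (congrArg (fun f => ModuleCat.Hom.hom f (1 : ℤ)) h4).symm.trans h2.symm
  simpa using h5

/-- A circle-valued map has a real lift along any curve whose homology class vanishes. -/
theorem exists_lift_of_curveClass_eq_zero {γ : C(Circle, X)} (h : curveClass γ = 0)
    (p : C(X, Circle)) : ∃ α : C(Circle, ℝ), ∀ z, Circle.exp (α z) = p (γ z) := by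
  obtain ⟨e, he⟩ := Circle.exp_surjective (p (γ (Circle.exp 0)))
  obtain ⟨G, ⟨-, hG⟩, -⟩ := Circle.isCoveringMap_exp.existsUnique_continuousMap_lifts
    (p.comp (γ.comp Circle.exp)) 0 e he
  replace hG : ∀ t, Circle.exp (G t) = p (γ (Circle.exp t)) := congrFun hG
  have h1 : G (2 * Real.pi) - G 0 = 0 := by
    have h0 := (argIncrement_eq (G.comp ⟨fun s : stdSimplex ℝ (Fin 2) => 2 * Real.pi * s.1 1,
      continuous_const.mul ((continuous_apply 1).comp continuous_subtype_val)⟩)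
      (fun s => hG _)).symm.trans (argIncrement_curveSimplex_eq_zero h p)
    simpa using h0
  -- G(t + 2π) and G(t) lift the same map, so their difference is constant, and it vanishes at t =
  -- 0.
  have hper : Function.Periodic G (2 * Real.pi) := fun t => by
    have h2 := sub_eq_sub_of_exp_eq (G.comp ⟨fun t => t + 2 * Real.pi, by fun_prop⟩) G
      (fun t => by simp [hG, Circle.exp_add]) t 0
    simp only [ContinuousMap.comp_apply, ContinuousMap.coe_mk, zero_add] at h2
    linarith
  have hq : Topology.IsQuotientMap Circle.exp := Circle.isCoveringMap_exp.isQuotientMap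
    Circle.exp_surjective
  have hfac : Function.FactorsThrough G Circle.exp := fun a b hab => by
    obtain ⟨m, rfl⟩ := Circle.exp_eq_exp.mp hab
    exact hper.int_mul m b
  refine ⟨hq.lift (f := Circle.exp) G hfac, fun z => ?_⟩
  · obtain ⟨t, rfl⟩ := Circle.exp_surjective z
    rw [← hG]
    congr 1
    exact DFunLike.congr_fun (hq.lift_comp G hfac) t

end Winding

end KnotTorus

namespace KnotTorus

/-! ### Homology classes of nullhomotopic curves. -/

section Nullhomotopic

variable {X Y : Type} [TopologicalSpace X] [TopologicalSpace Y]

/-- The map induced on the first homology group. -/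
noncomputable abbrev H1map (f : C(X, Y)) : H1 X ⟶ H1 Y :=
  HomologicalComplex.homologyMap (((singularChainComplexFunctor (ModuleCat ℤ)).obj
    (ModuleCat.of ℤ ℤ)).map (TopCat.ofHom f)) 1

theorem curveClass_comp (f : C(X, Y)) (γ : C(Circle, X)) :
    curveClass (f.comp γ) = (H1map f).hom (curveClass γ) := by
  let φ : singularChains X ⟶ singularChains Y := ((singularChainComplexFunctor (ModuleCat ℤ)).obj
    (ModuleCat.of ℤ ℤ)).map (TopCat.ofHom f)
  have h1 : curveChain γ ≫ φ.f 1 = curveChain (f.comp γ) :=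
    SSet.ι_chainComplexMap_f _ _ (TopCat.toSSet.map (TopCat.ofHom f)) (ModuleCat.of ℤ ℤ)
      (curveSimplex γ)
  have h2 : ((singularChains X).liftCycles (curveChain γ) 0 (by simp) (curveChain_d γ) ≫
      (singularChains X).homologyπ 1) ≫ HomologicalComplex.homologyMap φ 1 =
      (singularChains Y).liftCycles (curveChain (f.comp γ)) 0 (by simp) (curveChain_d _) ≫
        (singularChains Y).homologyπ 1 := by
    rw [Category.assoc, HomologicalComplex.homologyπ_naturality,
      HomologicalComplex.liftCycles_comp_cyclesMap_assoc]
    congr 2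
  exact congrArg (fun g => ModuleCat.Hom.hom g (1 : ℤ)) h2.symm

theorem H1map_eq_of_homotopic {f g : C(X, Y)} (h : f.Homotopic g) : H1map f = H1map g :=
  h.elim fun H => TopCat.Homotopy.congr_homologyMap_singularChainComplexFunctor
    (f := TopCat.ofHom f) (g := TopCat.ofHom g) H _ 1

theorem curveClass_eq_zero_of_subsingleton [Subsingleton X] (γ : C(Circle, X)) :
    curveClass γ = 0 := by
  have h := isZero_singularHomologyFunctor_of_totallyDisconnectedSpace (ModuleCat ℤ) 1
    (ModuleCat.of ℤ ℤ) (TopCat.of X) one_ne_zero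
  exact (ModuleCat.subsingleton_of_isZero h).elim _ _

/-- The homology class of a nullhomotopic curve vanishes. -/
theorem curveClass_eq_zero_of_nullhomotopic {γ : C(Circle, X)} (h : γ.Nullhomotopic) :
    curveClass γ = 0 := by
  obtain ⟨x, hx⟩ := h
  -- The class of `γ` is the image under `γ` of the class of the identity curve, so it depends only
  -- on the homotopy class of `γ`. A constant curve factors through a point.
  have h1 : curveClass γ = curveClass (ContinuousMap.const Circle x) := by
    have h2 := curveClass_comp γ (ContinuousMap.id Circle)
    have h3 := curveClass_comp (ContinuousMap.const Circle x) (ContinuousMap.id Circle)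
    rw [H1map_eq_of_homotopic hx] at h2
    exact h2.trans h3.symm
  have h4 := curveClass_comp (ContinuousMap.const Unit x) (ContinuousMap.const Circle ())
  rw [curveClass_eq_zero_of_subsingleton (ContinuousMap.const Circle ())] at h4
  rw [h1]
  refine Eq.trans ?_ (h4.trans (map_zero (H1map (ContinuousMap.const Unit x)).hom))
  rfl

end Nullhomotopic

end KnotTorus

namespace KnotTorus

/-! ### Jordan domains disjoint from their boundary's expanded copies. -/

section SpiralDisk

open Set Metric

/-- A connected set can leave an open set only through its frontier. -/
theorem subset_of_disjoint_frontier {X : Type*} [TopologicalSpace X] {C U : Set X}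
    (hC : IsPreconnected C) (hU : IsOpen U) (hd : Disjoint (frontier U) C)
    (hne : (C ∩ U).Nonempty) : C ⊆ U := by
  refine hC.subset_of_closure_inter_subset hU hne fun x hx => ?_
  by_contra hxU
  exact disjoint_left.mp hd (by rw [hU.frontier_eq]; exact ⟨hx.1, hxU⟩) hx.2

variable {U R : Set ℂ} {Φ g : ℂ → ℂ} {μ : ℂ}

/-- A domain around the origin bounded by a curve contains a contracted copy of its closure, if the
curve is disjoint from its expanded copy. -/
theorem smul_closure_subset (hU : IsOpen U) (hUc : IsPreconnected U)
    (hUb : Bornology.IsBounded U) (h0 : (0 : ℂ) ∈ U) (hfr : frontier U ⊆ R) (hR : IsPreconnected R)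
    (hRc : IsCompact R) (hμ : 1 < ‖μ‖) (hdR : ∀ z ∈ R, μ * z ∉ R)
    {z : ℂ} (hz : z ∈ closure U) : μ⁻¹ * z ∈ U := by
  have hμ0 : μ ≠ 0 := norm_pos_iff.mp (one_pos.trans hμ)
  obtain hRe | hRe := R.eq_empty_or_nonempty
  · have h1 : U = univ := by
      refine univ_subset_iff.mp (subset_of_disjoint_frontier isPreconnected_univ hU ?_
        ⟨0, trivial, h0⟩)
      rw [hRe] at hfr
      rw [subset_empty_iff.mp hfr]
      exact empty_disjoint _
    rw [h1]; trivial
  obtain ⟨z₀, hz₀, hmax⟩ := hRc.exists_isMaxOn hRe continuous_norm.continuousOn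
  have hle : ∀ w ∈ closure U, ‖w‖ ≤ ‖z₀‖ := fun w hw =>
    Complex.norm_le_of_forall_mem_frontier_norm_le (f := id) hUb differentiable_id.diffContOnCl
      (fun v hv => hmax (hfr hv)) hw
  -- the origin lies in `U`, so the maximal modulus is positive
  have hz₀0 : 0 < ‖z₀‖ := by
    obtain ⟨ε, hε, hεU⟩ := Metric.isOpen_iff.mp hU 0 h0
    have h1 := hle ((ε / 2 : ℝ) : ℂ) (subset_closure (hεU (by
      rw [mem_ball_zero_iff, Complex.norm_real, Real.norm_of_nonneg (by positivity)]; linarith)))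
    rw [Complex.norm_real, Real.norm_of_nonneg (by positivity)] at h1
    linarith
  -- If μR met the closure of `U`, then, being connected and off the frontier, it would lie in `U`.
  -- But μz₀ is farther from 0 than any point of the closure.
  have hdis : ∀ w ∈ R, μ * w ∉ closure U := by
    by_contra! hcon
    obtain ⟨w, hw, hwU⟩ := hcon
    have hwU' : μ * w ∈ U := by
      by_contra hn
      exact hdR w hw (hfr (by rw [hU.frontier_eq]; exact ⟨hwU, hn⟩))
    have h1 : (fun v => μ * v) '' R ⊆ U := by
      refine subset_of_disjoint_frontier (hR.image _ (by fun_prop)) hU ?_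
        ⟨_, mem_image_of_mem _ hw, hwU'⟩
      rw [disjoint_left]
      rintro _ hv ⟨v, hvR, rfl⟩
      exact hdR v hvR (hfr hv)
    have h2 := hle _ (subset_closure (h1 (mem_image_of_mem _ hz₀)))
    rw [norm_mul] at h2
    nlinarith
  have h1 : (fun v => μ⁻¹ * v) '' closure U ⊆ U := by
    refine subset_of_disjoint_frontier (hUc.closure.image _ (by fun_prop)) hU ?_
      ⟨0, ⟨0, subset_closure h0, by simp⟩, h0⟩
    rw [disjoint_left]
    rintro _ hv ⟨v, hvR, rfl⟩
    refine hdis _ (hfr hv) ?_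
    rwa [mul_inv_cancel_left₀ hμ0]
  exact h1 (mem_image_of_mem _ hz)

/-- By the Schwarz lemma, points of the same modulus do not differ by an expansion in the Riemann
coordinate. -/
theorem IsRiemannPair.eq_zero_of_eq_mul (h : IsRiemannPair U Φ g)
    (hUb : Bornology.IsBounded U) (hμ0 : μ ≠ 0)
    (hμU : ∀ z ∈ closure U, μ⁻¹ * z ∈ U) {z z' : ℂ} (hz : z ∈ ball (0 : ℂ) 1) (hzz : ‖z‖ = ‖z'‖)
    (heq : Φ z = μ * Φ z') : z = 0 := by
  have hz' : z' ∈ ball (0 : ℂ) 1 := by rwa [mem_ball_zero_iff, ← hzz, ← mem_ball_zero_iff]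
  have h0U : (0 : ℂ) ∈ U := h.map_zero ▸ h.mapsTo (mem_ball_self one_pos)
  have hg0 : g 0 = 0 := by simpa [h.map_zero] using h.left_inv 0 (mem_ball_self one_pos)
  have hcpt : IsCompact (closure U) := hUb.isCompact_closure
  have hcont : ContinuousOn (fun w => g (μ⁻¹ * w)) (closure U) :=
    h.diff_inv.continuousOn.comp (by fun_prop) hμU
  obtain ⟨w₀, hw₀, hmax⟩ := hcpt.exists_isMaxOn ⟨0, subset_closure h0U⟩ hcont.norm
  have hρ : ‖g (μ⁻¹ * w₀)‖ < 1 := mem_ball_zero_iff.mp (h.mapsTo_inv (hμU _ hw₀))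
  have hd : DifferentiableOn ℂ (fun w => g (μ⁻¹ * Φ w)) (ball 0 1) :=
    h.diff_inv.comp (h.diff.const_mul _) fun w hw => hμU _ (subset_closure (h.mapsTo hw))
  have hf0 : g (μ⁻¹ * Φ 0) = 0 := by rw [h.map_zero, mul_zero, hg0]
  -- The map w ↦ g(μ⁻¹Φ(w)) fixes 0, sends z to z', and by compactness has image in a disk of radius
  -- less than 1. Hence |z'| ≤ ρ|z| with ρ < 1.
  have hS := Complex.dist_le_div_mul_dist_of_mapsTo_ball (R₂ := ‖g (μ⁻¹ * w₀)‖) hd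
    (fun w hw => by
      rw [hf0, mem_closedBall_zero_iff]
      exact hmax (subset_closure (h.mapsTo hw))) hz
  rw [hf0, heq, inv_mul_cancel_left₀ hμ0, h.left_inv _ hz', dist_zero_right, dist_zero_right,
    div_one, ← hzz] at hS
  rw [← norm_eq_zero]
  nlinarith [norm_nonneg z]

/-- At 0 the value is Φ'(0), nonzero because `g` is a differentiable local inverse; elsewhere it is
Φ(z)/z, nonzero by injectivity. This permits dividing ψ by its modulus. -/
theorem IsRiemannPair.dslope_ne_zero (h : IsRiemannPair U Φ g) (hU : IsOpen U)
    (hinj : InjOn Φ (closedBall 0 1)) {z : ℂ} (hz : z ∈ closedBall (0 : ℂ) 1) :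
    dslope Φ 0 z ≠ 0 := by
  obtain rfl | hz0 := eq_or_ne z 0
  · rw [dslope_same]
    intro hd
    have h0U : (0 : ℂ) ∈ U := h.map_zero ▸ h.mapsTo (mem_ball_self one_pos)
    have h1 := (h.diff.differentiableAt (ball_mem_nhds _ one_pos)).hasDerivAt
    rw [hd] at h1
    have h2 : HasDerivAt g (deriv g (Φ 0)) (Φ 0) := by
      rw [h.map_zero]
      exact (h.diff_inv.differentiableAt (hU.mem_nhds h0U)).hasDerivAt
    have h3 := (h2.comp 0 h1).congr_of_eventuallyEq
      (Filter.eventuallyEq_of_mem (ball_mem_nhds (0 : ℂ) one_pos) fun w hw =>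
        (h.left_inv w hw).symm)
    have h4 := h3.unique (hasDerivAt_id 0)
    rw [mul_zero] at h4
    exact zero_ne_one h4
  · rw [dslope_of_ne _ hz0, slope_def_field, h.map_zero, sub_zero, sub_zero]
    refine div_ne_zero (fun h0 => hz0 ?_) hz0
    exact hinj hz (mem_closedBall_self zero_le_one) (h0.trans h.map_zero.symm)

end SpiralDisk

/-! ### The meridian disk in the standard solid torus. -/

section MeridianDisk

open Set Metric

/-- The inclusion of the circle into the closed disk. -/
def circleToDisk (z : Circle) : ClosedDisk :=
  ⟨z, by rw [mem_closedBall_zero_iff, Circle.norm_coe]⟩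

theorem continuous_circleToDisk : Continuous circleToDisk :=
  Continuous.subtype_mk continuous_subtype_val _

variable {α : C(Circle, ℝ)} {b : C(Circle, Circle)}

/-- A simple closed curve on the boundary torus whose first coordinate lifts to the line, and whose
second coordinate does not, bounds a disk in the solid torus. -/
theorem exists_meridian_disk (hinj : Function.Injective fun t => (Circle.exp (α t), b t))
    (hb : ¬ ∃ β : C(Circle, ℝ), ∀ t, Circle.exp (β t) = b t) :
    ∃ d : ClosedDisk → SolidTorus, Continuous d ∧ Function.Injective d ∧
      d '' ClosedDisk.boundary = range fun t => (Circle.exp (α t), circleToDisk (b t)) := by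
  set J : Circle → ℂ := fun t => (Real.exp (α t) : ℂ) * b t with hJdef
  have hJ : Continuous J := by fun_prop
  have hJn : ∀ t, ‖J t‖ = Real.exp (α t) := fun t => by
    rw [norm_mul, Circle.norm_coe, mul_one, Complex.norm_real,
      Real.norm_of_nonneg (Real.exp_nonneg _)]
  have hJ0 : ∀ t, J t ≠ 0 := fun t => norm_pos_iff.mp (hJn t ▸ Real.exp_pos _)
  -- Disjointness of the deck translates of `J`: the modulus determines α, and a shift of α by 2πm
  -- leaves the point of the torus unchanged, so injectivity of the curve applies.
  have hJeq : ∀ (m : ℤ) t t', J t = Real.exp (m * (2 * Real.pi)) * J t' → t = t' ∧ m = 0 := by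
    intro m t t' h
    have h1 : α t = m * (2 * Real.pi) + α t' := by
      have h2 := congrArg norm h
      rw [hJn, norm_mul, hJn, Complex.norm_real, Real.norm_of_nonneg (Real.exp_nonneg _),
        ← Real.exp_add] at h2
      exact Real.exp_injective h2
    have h2 : b t = b t' := by
      simp only [hJdef] at h
      rw [h1, Real.exp_add, Complex.ofReal_mul, mul_assoc] at h
      have h3 := mul_left_cancel₀ (Complex.ofReal_ne_zero.mpr (Real.exp_ne_zero _)) h
      exact Circle.ext (mul_left_cancel₀ (Complex.ofReal_ne_zero.mpr (Real.exp_ne_zero _)) h3)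
    have h3 : t = t' := hinj (Prod.ext (Circle.exp_eq_exp.mpr ⟨m, by rw [h1, add_comm]⟩) h2)
    refine ⟨h3, ?_⟩
    rw [h3] at h1
    have h4 : (m : ℝ) * (2 * Real.pi) = 0 := by linarith
    exact_mod_cast (mul_eq_zero.mp h4).resolve_right Real.two_pi_pos.ne'
  have hJinj : Function.Injective J := fun t t' h => (hJeq 0 t t' (by simpa using h)).1
  have hlog : ¬ HasContLog univ J := by
    rintro ⟨L, hL, hexp⟩
    refine hb ⟨⟨fun t => (L t).im, Complex.continuous_im.comp (continuousOn_univ.mp hL)⟩,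
      fun t => Circle.ext ?_⟩
    have h1 := hexp t trivial
    have h2 : Real.exp (L t).re = Real.exp (α t) := by
      rw [← Complex.norm_exp, h1, hJn]
    have h3 : (Real.exp (α t) : ℂ) * Complex.exp ((L t).im * Complex.I) = Real.exp (α t) * b t := by
      refine Eq.trans ?_ h1
      rw [← h2, Complex.ofReal_exp, ← Complex.exp_add, Complex.re_add_im]
    exact mul_left_cancel₀ (Complex.ofReal_ne_zero.mpr (Real.exp_ne_zero _)) h3
  obtain ⟨U, Φ, g, hU, hUc, hUb, hfr, hdisj, h, hc, hΦ, hsph⟩ :=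
    exists_jordan_domain hJ hJinj hJ0 hlog
  have h0U : (0 : ℂ) ∈ U := h.map_zero ▸ h.mapsTo (mem_ball_self one_pos)
  have key : ∀ m : ℤ, 0 < m → ∀ z z' : ℂ, ‖z‖ ≤ 1 → ‖z‖ = ‖z'‖ →
      Φ z = Real.exp (m * (2 * Real.pi)) * Φ z' → z = 0 := by
    intro m hm z z' hz hzz heq
    obtain hz1 | hz1 := hz.lt_or_eq
    · refine h.eq_zero_of_eq_mul hUb (Complex.ofReal_ne_zero.mpr (Real.exp_ne_zero _))
        (fun w hw => ?_) (mem_ball_zero_iff.mpr hz1) hzz heq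
      refine smul_closure_subset hU hUc.isPreconnected hUb h0U hfr (isPreconnected_range hJ)
        (isCompact_range hJ) ?_ ?_ hw
      · rw [Complex.norm_real, Real.norm_of_nonneg (Real.exp_nonneg _)]
        exact Real.one_lt_exp_iff.mpr (mul_pos (by exact_mod_cast hm) Real.two_pi_pos)
      · rintro _ ⟨t, rfl⟩ ⟨t', ht'⟩
        exact hm.ne' (hJeq m t' t ht').2
    · have h1 : Φ z ∈ range J := hsph ▸ mem_image_of_mem _ (mem_sphere_zero_iff_norm.mpr hz1)
      have h2 : Φ z' ∈ range J :=
        hsph ▸ mem_image_of_mem _ (mem_sphere_zero_iff_norm.mpr (hzz ▸ hz1))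
      obtain ⟨t, ht⟩ := h1
      obtain ⟨t', ht'⟩ := h2
      rw [← ht, ← ht'] at heq
      exact absurd (hJeq m t t' heq).2 hm.ne'
  set ψ : ℂ → ℂ := dslope Φ 0 with hψdef
  have hψc : ContinuousOn ψ (closedBall 0 1) :=
    (continuousOn_dslope (closedBall_mem_nhds _ one_pos)).mpr
      ⟨hc, h.diff.differentiableAt (ball_mem_nhds _ one_pos)⟩
  have hψ0 : ∀ z ∈ closedBall (0 : ℂ) 1, ψ z ≠ 0 := fun z hz => h.dslope_ne_zero hU hΦ hz
  have hψ : ∀ z, z * ψ z = Φ z := fun z => by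
    have := sub_smul_dslope Φ 0 z
    rwa [h.map_zero, sub_zero, sub_zero, smul_eq_mul] at this
  have hnorm : ∀ z : ClosedDisk, ‖(z : ℂ) * (ψ z / ‖ψ z‖)‖ = ‖(z : ℂ)‖ := fun z => by
    rw [norm_mul, norm_div, Complex.norm_real, norm_norm,
      div_self (norm_ne_zero_iff.mpr (hψ0 z z.2)), mul_one]
  have hψc' : Continuous fun z : ClosedDisk => ψ z := hψc.comp_continuous continuous_subtype_val
    fun z => z.2
  -- Φ in polar form, with log|ψ| wrapped around the core circle. Using ψ instead of Φ avoids the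
  -- logarithm of 0 at the centre, and on |z| = 1 it gives the polar coordinates of Φ(z) itself.
  let d : ClosedDisk → SolidTorus := fun z => (Circle.exp (Real.log ‖ψ z‖),
    ⟨(z : ℂ) * (ψ z / ‖ψ z‖), by
      rw [mem_closedBall_zero_iff, hnorm]; exact mem_closedBall_zero_iff.mp z.2⟩)
  have hdbd : ∀ (z : ClosedDisk) t, ‖(z : ℂ)‖ = 1 → J t = Φ z →
      d z = (Circle.exp (α t), circleToDisk (b t)) := by
    intro z t hz hzt
    have h1 : ‖ψ z‖ = Real.exp (α t) := by
      rw [← hJn, hzt, ← hψ, norm_mul, hz, one_mul]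
    refine Prod.ext ?_ (Subtype.ext ?_)
    · show Circle.exp (Real.log ‖ψ z‖) = _
      rw [h1, Real.log_exp]
    · show (z : ℂ) * (ψ z / ‖ψ z‖) = b t
      rw [← mul_div_assoc, hψ, ← hzt, h1, hJdef]
      exact mul_div_cancel_left₀ _ (Complex.ofReal_ne_zero.mpr (Real.exp_ne_zero _))
  refine ⟨d, ?_, ?_, ?_⟩
  · refine (Circle.exp.continuous.comp (hψc'.norm.log fun z =>
      norm_ne_zero_iff.mpr (hψ0 z z.2))).prodMk (Continuous.subtype_mk ?_ _)
    exact continuous_subtype_val.mul (hψc'.div (Complex.continuous_ofReal.comp hψc'.norm) fun z =>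
      Complex.ofReal_ne_zero.mpr (norm_ne_zero_iff.mpr (hψ0 z z.2)))
  · intro z z' hzz
    have h1 : Circle.exp (Real.log ‖ψ z‖) = Circle.exp (Real.log ‖ψ z'‖) := congrArg Prod.fst hzz
    have h2 : (z : ℂ) * (ψ z / ‖ψ z‖) = z' * (ψ z' / ‖ψ z'‖) :=
      congrArg (fun p : SolidTorus => (p.2 : ℂ)) hzz
    have h3 : ‖(z : ℂ)‖ = ‖(z' : ℂ)‖ := by rw [← hnorm z, h2, hnorm z']
    have hn : ‖ψ z‖ ≠ 0 := norm_ne_zero_iff.mpr (hψ0 z z.2)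
    have hn' : ‖ψ z'‖ ≠ 0 := norm_ne_zero_iff.mpr (hψ0 z' z'.2)
    obtain ⟨m, hm⟩ := Circle.exp_eq_exp.mp h1
    have h4 : ‖ψ z‖ = Real.exp (m * (2 * Real.pi)) * ‖ψ z'‖ := by
      rw [← Real.exp_log (norm_pos_iff.mpr (hψ0 z z.2)), hm, add_comm, Real.exp_add,
        Real.exp_log (norm_pos_iff.mpr (hψ0 z' z'.2))]
    have h5 : Φ z = Real.exp (m * (2 * Real.pi)) * Φ z' := by
      rw [← mul_div_assoc, ← mul_div_assoc, hψ, hψ, h4, div_eq_div_iff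
        (by rw [← h4]; exact_mod_cast hn) (by exact_mod_cast hn')] at h2
      have h6 : (‖ψ z'‖ : ℂ) ≠ 0 := by exact_mod_cast hn'
      refine mul_right_cancel₀ h6 (h2.trans ?_)
      push_cast
      ring
    have hz1 : ‖(z : ℂ)‖ ≤ 1 := mem_closedBall_zero_iff.mp z.2
    have hfin : (z : ℂ) = 0 → z = z' := fun h0 => Subtype.ext (by
      rw [h0, norm_zero] at h3
      rw [h0, norm_eq_zero.mp h3.symm])
    obtain hm0 | rfl | hm0 := lt_trichotomy m 0
    · refine hfin (norm_eq_zero.mp (h3.trans (norm_eq_zero.mpr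
        (key (-m) (by omega) z' z (h3 ▸ hz1) h3.symm ?_))))
      rw [h5, ← mul_assoc, ← Complex.ofReal_mul, ← Real.exp_add]
      simp
    · exact Subtype.ext (hΦ z.2 z'.2 (by simpa using h5))
    · exact hfin (key m hm0 z z' hz1 h3 h5)
  · ext p
    constructor
    · rintro ⟨z, hz, rfl⟩
      have h1 : Φ z ∈ range J := hsph ▸ mem_image_of_mem _ (mem_sphere_zero_iff_norm.mpr hz)
      obtain ⟨t, ht⟩ := h1
      exact ⟨t, (hdbd z t hz ht).symm⟩
    · rintro ⟨t, rfl⟩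
      have h1 : J t ∈ Φ '' sphere 0 1 := hsph ▸ mem_range_self t
      obtain ⟨z, hz, hzt⟩ := h1
      exact ⟨⟨z, sphere_subset_closedBall hz⟩, mem_sphere_zero_iff_norm.mp hz,
        hdbd _ t (mem_sphere_zero_iff_norm.mp hz) hzt.symm⟩

end MeridianDisk

end KnotTorus

namespace KnotTorus

/-! ### Transfer to the embedded solid torus and the equivalence. -/

section Nullhomotopy

instance : ContractibleSpace ClosedDisk :=
  (convex_closedBall (0 : ℂ) 1).contractibleSpace (Metric.nonempty_closedBall.mpr zero_le_one)

theorem nullhomotopic_of_factors {X Y Z : Type*} [TopologicalSpace X] [TopologicalSpace Y]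
    [TopologicalSpace Z] [ContractibleSpace Y] {f : C(X, Z)} (g : C(X, Y)) (k : C(Y, Z))
    (h : ∀ x, k (g x) = f x) : f.Nullhomotopic := by
  have h1 := ((id_nullhomotopic Y).comp_left g).comp_right k
  have h2 : k.comp ((ContinuousMap.id Y).comp g) = f := ContinuousMap.ext h
  rwa [h2] at h1

variable {K : OrientedKnot} (N : SolidTorusNbhd K)

/-- The homeomorphism of the standard solid torus with `N`. -/
noncomputable def SolidTorusNbhd.homeomorph : SolidTorus ≃ₜ N.carrier := N.isEmbedding.toHomeomorph

variable {N}

theorem norm_homeomorph_symm_snd (x : N.boundary) :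
    ‖((N.homeomorph.symm (N.boundaryInclusion x)).2 : ℂ)‖ = 1 := by
  obtain ⟨_, p, hp, rfl⟩ := x
  have h : N.boundaryInclusion ⟨N.toFun p, p, hp, rfl⟩ = N.homeomorph p := rfl
  rw [h, Homeomorph.symm_apply_apply]
  exact hp

theorem nullhomotopic_of_boundsDisk {X : Type} [TopologicalSpace X] {γ : C(Circle, X)}
    (h : BoundsDisk γ) : γ.Nullhomotopic := by
  obtain ⟨d, hd, hdγ⟩ := h
  have hmem : ∀ t, γ t ∈ Set.range d := fun t =>
    Set.image_subset_range _ _ (hdγ ▸ Set.mem_range_self t)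
  refine nullhomotopic_of_factors
    ⟨fun t => hd.toHomeomorph.symm ⟨γ t, hmem t⟩, by fun_prop⟩ ⟨d, hd.continuous⟩ fun t => ?_
  exact congrArg Subtype.val (hd.toHomeomorph.apply_symm_apply ⟨γ t, hmem t⟩)

/-- The second coordinate of a curve on the boundary torus. -/
noncomputable def boundaryAngle (η : C(Circle, N.boundary)) : C(Circle, Circle) :=
  ⟨fun t => ⟨(N.homeomorph.symm (N.boundaryInclusion (η t))).2,
    mem_sphere_zero_iff_norm.mpr (norm_homeomorph_symm_snd (η t))⟩, by
    refine Continuous.subtype_mk ?_ _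
    fun_prop⟩

theorem circleToDisk_boundaryAngle (η : C(Circle, N.boundary)) (t : Circle) :
    circleToDisk (boundaryAngle η t) = (N.homeomorph.symm (pushIn N η t)).2 := rfl

/-- A curve on the boundary torus both of whose coordinates lift is nullhomotopic there. -/
theorem nullhomotopic_of_lifts (η : C(Circle, N.boundary)) {α β : C(Circle, ℝ)}
    (hα : ∀ t, Circle.exp (α t) = (N.homeomorph.symm (pushIn N η t)).1)
    (hβ : ∀ t, Circle.exp (β t) = boundaryAngle η t) : η.Nullhomotopic := by
  refine nullhomotopic_of_factors (Y := ℝ × ℝ) ⟨fun t => (α t, β t), by fun_prop⟩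
    ⟨fun p => ⟨N.toFun (Circle.exp p.1, circleToDisk (Circle.exp p.2)), _,
      Circle.norm_coe _, rfl⟩, ?_⟩ fun t => Subtype.ext ?_
  · refine Continuous.subtype_mk (N.isEmbedding.continuous.comp ?_) _
    exact (Circle.exp.continuous.comp continuous_fst).prodMk
      (continuous_circleToDisk.comp (Circle.exp.continuous.comp continuous_snd))
  · show N.toFun (Circle.exp (α t), circleToDisk (Circle.exp (β t))) = η t
    rw [hα, hβ, circleToDisk_boundaryAngle]
    exact congrArg Subtype.val (N.homeomorph.apply_symm_apply (pushIn N η t))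

/-- Essentiality enters twice: simplicity of η makes the pair of coordinates injective, and its
nonzero class on ∂N rules out a lift of the second coordinate. The resulting map of the compact disk
is an embedding because it is continuous and injective into a Hausdorff space. -/
theorem boundsDisk_of_lift {η : C(Circle, N.boundary)} (hη : IsEssential N η) {α : C(Circle, ℝ)}
    (hα : ∀ t, Circle.exp (α t) = (N.homeomorph.symm (pushIn N η t)).1) :
    BoundsDisk (pushIn N η) := by
  have hpair : ∀ t, (Circle.exp (α t), circleToDisk (boundaryAngle η t)) =
      N.homeomorph.symm (pushIn N η t) := fun t => Prod.ext (hα t) rfl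
  obtain ⟨d, hdc, hdi, hd⟩ := exists_meridian_disk (α := α) (b := boundaryAngle η)
    (fun t t' h => by
      have h1 : N.homeomorph.symm (pushIn N η t) = N.homeomorph.symm (pushIn N η t') := by
        rw [← hpair, ← hpair]
        exact congrArg (fun p : Circle × Circle => (p.1, circleToDisk p.2)) h
      exact hη.1 (Set.inclusion_injective N.boundary_subset (N.homeomorph.symm.injective h1)))
    (fun ⟨β, hβ⟩ => hη.2 (curveClass_eq_zero_of_nullhomotopic (nullhomotopic_of_lifts η hα hβ)))
  refine ⟨fun z => N.homeomorph (d z), ((N.homeomorph.continuous.comp hdc).isClosedEmbedding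
    (N.homeomorph.injective.comp hdi)).isEmbedding, ?_⟩
  rw [← Set.image_image, hd, ← Set.range_comp]
  congr 1
  funext t
  show N.homeomorph (Circle.exp (α t), circleToDisk (boundaryAngle η t)) = _
  rw [hpair, Homeomorph.apply_symm_apply]

end Nullhomotopy

end KnotTorus

theorem mainTheorem11 (K : KnotTorus.OrientedKnot) (N : KnotTorus.SolidTorusNbhd K)
    (η : C(Circle, N.boundary)) (hη : KnotTorus.IsEssential N η) :
    List.TFAE [
      KnotTorus.curveClass (KnotTorus.pushIn N η) = 0,
      (KnotTorus.pushIn N η).Nullhomotopic,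
      KnotTorus.BoundsDisk (KnotTorus.pushIn N η)] := by
  have hlift (h : KnotTorus.curveClass (KnotTorus.pushIn N η) = 0) : ∃ α : C(Circle, ℝ),
      ∀ t, Circle.exp (α t) = (N.homeomorph.symm (KnotTorus.pushIn N η t)).1 :=
    KnotTorus.exists_lift_of_curveClass_eq_zero h
      ⟨fun x => (N.homeomorph.symm x).1, by fun_prop⟩
  tfae_have 1 → 3 := fun h => (hlift h).elim fun _ hα => KnotTorus.boundsDisk_of_lift hη hα
  tfae_have 3 → 2 := KnotTorus.nullhomotopic_of_boundsDisk
  tfae_have 2 → 1 := KnotTorus.curveClass_eq_zero_of_nullhomotopic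
  tfae_finish
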